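/- Equip $\mathbb{R}^{2n}$, with coordinates $x_1,y_1,\dots,x_n,y_n$, with the standard symplectic form $\omega=\sum_{i=1}^n dx_i\wedge dy_i$. For positive radii $R_1\le\dots\le R_n$ let $P(R_1,\dots,R_n)$ be the open polydisk of all points with $x_i^2+y_i^2<R_i^2$ for every $i$. An open set $U\subseteq\mathbb{R}^{2n}$ symplectically embeds in $V\subseteq\mathbb{R}^{2n}$ if there is a smooth embedding $f:U\to\mathbb{R}^{2n}$ with $f(U)\subseteq V$ and $f^*\omega=\omega$ on $U$. Theorem. For every integer $n\ge 1$ there is a constant $C(n)>0$, depending only on $n$, such that the following holds. Let $0<R_1\le\dots\le R_n$ and $0<R'_1\le\dots\le R'_n$. If $R_1\le R'_1$ and $R_1\cdots R_n\le R'_1\cdots R'_n$, then $P(R_1,\dots,R_n)$ symplectically embeds in $P(C(n)R'_1,\dots,C(n)R'_n)$. -/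

import Mathlib

open scoped ContDiff

/-- The phase space `ℝ²ⁿ`: the `i`-th component of a point is the pair `(x_i, y_i)`. Only its
vector space structure, its topology and its smooth structure are used below, and these do not
depend on the choice of a norm. -/
abbrev PhaseSpace (n : ℕ) : Type := Fin n → ℝ × ℝ

/-- The standard symplectic form `ω = ∑ i, dx_i ∧ dy_i` on `ℝ²ⁿ`, evaluated at two tangent
vectors. -/
def stdSymplecticForm {n : ℕ} (u v : PhaseSpace n) : ℝ :=
  ∑ i, ((u i).1 * (v i).2 - (u i).2 * (v i).1)

/-- The open polydisk `B²(R_1) × ⋯ × B²(R_n)`. -/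
def polydisk {n : ℕ} (R : Fin n → ℝ) : Set (PhaseSpace n) :=
  {p | ∀ i, (p i).1 ^ 2 + (p i).2 ^ 2 < R i ^ 2}

/-- `f` restricts to a symplectic embedding of the open set `U` into `V`: a smooth map on `U`
with values in `V`, which is a homeomorphism onto its image and satisfies `f^* ω = ω` on `U`.
(The last condition makes every differential injective, so `f` is an immersion on `U`.) -/
structure IsSymplecticEmbedding {n : ℕ} (f : PhaseSpace n → PhaseSpace n)
    (U V : Set (PhaseSpace n)) : Prop where
  contDiffOn : ContDiffOn ℝ ∞ f U
  mapsTo : Set.MapsTo f U V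
  isEmbedding : Topology.IsEmbedding (U.domRestrict f)
  pullback_eq : ∀ p ∈ U, ∀ u v : PhaseSpace n,
    stdSymplecticForm (fderiv ℝ f p u) (fderiv ℝ f p v) = stdSymplecticForm u v

/-- The open set `U ⊆ ℝ²ⁿ` symplectically embeds in `V ⊆ ℝ²ⁿ`. -/
def SymplecticallyEmbeds {n : ℕ} (U V : Set (PhaseSpace n)) : Prop :=
  ∃ f : PhaseSpace n → PhaseSpace n, IsSymplecticEmbedding f U V

/-! ### Symplectic maps at a point -/

/-! Two moves change the radii while preserving their product, up to a constant factor. Folding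
(`exists_embeds_fold`) sends P(a, b) into C·P(as, b/s) when s ≥ 1 and as ≤ b. Squeezing
(`exists_embeds_squeeze`) sends P(a, b, c) into C·P(a, a, bc/a) when a ≤ b. Squeezing the middle
radii one at a time leads from R to (R_1, …, R_1, ∏R / R_1^(n-1)). The product hypothesis says
exactly that the last radius is at most ∏R' / R_1^(n-1). Folding then raises each R_1 to R'_i, which
is possible since R_1 ≤ R'_1 ≤ R'_i. The number of moves depends only on n, hence so does the
constant.

Folding winds a strip N ≈ s² times around an annulus, a linear shear rotating the other factor by
2π/N per turn so that the turns stay disjoint (`embeds_wrap`).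

Squeezing (`squeeze`) winds the second factor around the unit circle centred at (-1, 0). On the
upper half of each turn, the flow of v·g(a² + b²) advances the third factor by 1, which separates
the turns. It also rotates the plane about the origin by an uncontrolled angle, which may throw the
upper arc onto the lower one, but only at squared radii in (3/2, 5/2). There the lower arc has been
displaced by 1 in the first factor, so no collision occurs (`twist_ne_shift`). -/

/-- `f` is smooth at `p` and its differential there preserves the symplectic form. -/
structure IsSymplecticAt {n : ℕ} (f : PhaseSpace n → PhaseSpace n) (p : PhaseSpace n) : Prop where
  contDiffAt : ContDiffAt ℝ ∞ f p
  pullback_eq : ∀ u v : PhaseSpace n,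
    stdSymplecticForm (fderiv ℝ f p u) (fderiv ℝ f p v) = stdSymplecticForm u v

theorem eq_zero_of_stdSymplecticForm {n : ℕ} {u : PhaseSpace n}
    (h : ∀ v, stdSymplecticForm u v = 0) : u = 0 := by
  funext i
  have h1 := h (Pi.single i (0, 1))
  have h2 := h (Pi.single i (1, 0))
  simp only [stdSymplecticForm] at h1 h2
  rw [Finset.sum_eq_single i] at h1 h2
  · ext
    · simpa using h1
    · simpa using h2
  all_goals simp +contextual [Pi.single_eq_of_ne]

namespace IsSymplecticAt

variable {n : ℕ} {f g : PhaseSpace n → PhaseSpace n} {p : PhaseSpace n}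

theorem differentiableAt (hf : IsSymplecticAt f p) : DifferentiableAt ℝ f p :=
  hf.contDiffAt.differentiableAt (by simp)

theorem comp (hg : IsSymplecticAt g (f p)) (hf : IsSymplecticAt f p) :
    IsSymplecticAt (g ∘ f) p where
  contDiffAt := hg.contDiffAt.comp p hf.contDiffAt
  pullback_eq u v := by
    rw [fderiv_comp p hg.differentiableAt hf.differentiableAt]
    simp [hg.pullback_eq, hf.pullback_eq]

theorem congr (hf : IsSymplecticAt f p) (h : g =ᶠ[nhds p] f) : IsSymplecticAt g p where
  contDiffAt := hf.contDiffAt.congr_of_eventuallyEq h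
  pullback_eq u v := by rw [h.fderiv_eq]; exact hf.pullback_eq u v

theorem of_components {A B : Fin n → PhaseSpace n →L[ℝ] ℝ} (hf : ContDiffAt ℝ ∞ f p)
    (hA : ∀ i, HasFDerivAt (fun q => (f q i).1) (A i) p)
    (hB : ∀ i, HasFDerivAt (fun q => (f q i).2) (B i) p)
    (h : ∀ u v, ∑ i, (A i u * B i v - B i u * A i v) = stdSymplecticForm u v) :
    IsSymplecticAt f p where
  contDiffAt := hf
  pullback_eq u v := by
    have hd : HasFDerivAt f (ContinuousLinearMap.pi fun i => (A i).prod (B i)) p :=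
      hasFDerivAt_pi.2 fun i => (hA i).prodMk (hB i)
    rw [hd.fderiv]
    exact Eq.trans (by simp [stdSymplecticForm]) (h u v)

/-- Nondegeneracy of ω makes the differential injective, hence surjective by equality of dimensions,
and the inverse function theorem applies. -/
theorem map_nhds_eq (hf : IsSymplecticAt f p) : Filter.map f (nhds p) = nhds (f p) := by
  have hs : HasStrictFDerivAt f (fderiv ℝ f p) p := hf.contDiffAt.hasStrictFDerivAt (by simp)
  refine hs.map_nhds_eq_of_surj ?_
  refine LinearMap.range_eq_top.2 (LinearMap.injective_iff_surjective.1 ?_)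
  refine (injective_iff_map_eq_zero _).2 fun u hu => eq_zero_of_stdSymplecticForm fun v => ?_
  rw [← hf.pullback_eq u v]
  have : fderiv ℝ f p u = 0 := hu
  simp [this, stdSymplecticForm]

end IsSymplecticAt

/-! ### Symplectic embeddings: injectivity criterion, composition, inclusion, scaling -/

section Embeddings

variable {n : ℕ} {f g : PhaseSpace n → PhaseSpace n} {U V W : Set (PhaseSpace n)}

/-- Symplectic maps are open, so injectivity alone gives a homeomorphism onto the image. -/
theorem isSymplecticEmbedding_of_injOn (hU : IsOpen U) (hf : ∀ p ∈ U, IsSymplecticAt f p)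
    (hinj : U.InjOn f) (hmaps : U.MapsTo f V) : IsSymplecticEmbedding f U V where
  contDiffOn p hp := (hf p hp).contDiffAt.contDiffWithinAt
  mapsTo := hmaps
  isEmbedding := by
    have hc : Continuous (U.domRestrict f) := continuousOn_iff_continuous_domRestrict.1
      fun p hp => (hf p hp).contDiffAt.continuousAt.continuousWithinAt
    refine (Topology.IsOpenEmbedding.of_continuous_injective_isOpenMap hc
      (Set.injOn_iff_injective.1 hinj) ?_).isEmbedding
    refine IsOpenMap.of_nhds_le fun p => ?_
    have h1 := (hf p p.2).map_nhds_eq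
    have h2 := hU.isOpenEmbedding_subtypeVal.map_nhds_eq p
    rw [← h2, Filter.map_map] at h1
    exact h1.ge
  pullback_eq p hp := (hf p hp).pullback_eq

theorem IsSymplecticEmbedding.isSymplecticAt (hf : IsSymplecticEmbedding f U V) (hU : IsOpen U)
    {p : PhaseSpace n} (hp : p ∈ U) : IsSymplecticAt f p where
  contDiffAt := hf.contDiffOn.contDiffAt (hU.mem_nhds hp)
  pullback_eq := hf.pullback_eq p hp

theorem IsSymplecticEmbedding.injOn (hf : IsSymplecticEmbedding f U V) : U.InjOn f :=
  Set.injOn_iff_injective.2 hf.isEmbedding.injective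

theorem SymplecticallyEmbeds.trans (hU : IsOpen U) (hV : IsOpen V)
    (h : SymplecticallyEmbeds U V) (h' : SymplecticallyEmbeds V W) :
    SymplecticallyEmbeds U W := by
  obtain ⟨f, hf⟩ := h
  obtain ⟨g, hg⟩ := h'
  exact ⟨g ∘ f, isSymplecticEmbedding_of_injOn hU
    (fun p hp => (hg.isSymplecticAt hV (hf.mapsTo hp)).comp (hf.isSymplecticAt hU hp))
    (hg.injOn.comp hf.injOn hf.mapsTo) (hg.mapsTo.comp hf.mapsTo)⟩

theorem SymplecticallyEmbeds.of_subset (hU : IsOpen U) (h : U ⊆ V) :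
    SymplecticallyEmbeds U V :=
  ⟨id, isSymplecticEmbedding_of_injOn hU
    (fun p _ => ⟨contDiffAt_id, by simp⟩) (Set.injOn_id _) h⟩

theorem isOpen_polydisk (R : Fin n → ℝ) : IsOpen (polydisk R) := by
  simp only [polydisk, Set.ofPred_forall]
  exact isOpen_iInter_of_finite fun i => isOpen_lt (by fun_prop) (by fun_prop)

theorem polydisk_subset {R R' : Fin n → ℝ} (h0 : ∀ i, 0 ≤ R i) (h : ∀ i, R i ≤ R' i) :
    polydisk R ⊆ polydisk R' :=
  fun _ hp i => (hp i).trans_le (pow_le_pow_left₀ (h0 i) (h i) 2)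

/-- Conjugating by a dilation multiplies ω by c² and by c⁻², which cancel. -/
theorem SymplecticallyEmbeds.smul {R R' : Fin n → ℝ} {c : ℝ} (hc : 0 < c)
    (h : SymplecticallyEmbeds (polydisk R) (polydisk R')) :
    SymplecticallyEmbeds (polydisk (fun i => c * R i)) (polydisk (fun i => c * R' i)) := by
  obtain ⟨f, hf⟩ := h
  have hmem : ∀ p ∈ polydisk (fun i => c * R i), c⁻¹ • p ∈ polydisk R := by
    intro p hp i
    have := hp i
    simp only [Pi.smul_apply, Prod.smul_fst, Prod.smul_snd, smul_eq_mul]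
    have h2 : (c⁻¹ * (p i).1) ^ 2 + (c⁻¹ * (p i).2) ^ 2
        = (c⁻¹) ^ 2 * ((p i).1 ^ 2 + (p i).2 ^ 2) := by ring
    rw [h2, inv_pow, inv_mul_lt_iff₀ (by positivity)]
    linarith [mul_pow c (R i) 2]
  have hsc : ∀ a : ℝ, ∀ u v : PhaseSpace n,
      stdSymplecticForm (a • u) (a • v) = a ^ 2 * stdSymplecticForm u v := by
    intro a u v
    simp only [stdSymplecticForm, Finset.mul_sum]
    exact Finset.sum_congr rfl fun i _ => by
      simp only [Pi.smul_apply, Prod.smul_fst, Prod.smul_snd, smul_eq_mul]; ring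
  refine ⟨fun p => c • f (c⁻¹ • p), isSymplecticEmbedding_of_injOn (isOpen_polydisk _)
    (fun p hp => ?_) (fun p hp q hq hpq => ?_) (fun p hp i => ?_)⟩
  · have hs := hf.isSymplecticAt (isOpen_polydisk _) (hmem p hp)
    refine ⟨ContDiffAt.const_smul c (hs.contDiffAt.comp p (g := f) (f := fun p => c⁻¹ • p)
      (by fun_prop)),
      fun u v => ?_⟩
    have hd : HasFDerivAt (fun p => c • f (c⁻¹ • p))
        (c • (fderiv ℝ f (c⁻¹ • p)).comp (c⁻¹ • ContinuousLinearMap.id ℝ (PhaseSpace n))) p :=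
      (hs.differentiableAt.hasFDerivAt.comp p
        ((hasFDerivAt_id p).const_smul c⁻¹)).const_smul c
    rw [hd.fderiv]
    simp only [smul_apply, ContinuousLinearMap.comp_apply,
      ContinuousLinearMap.id_apply]
    rw [hsc, hs.pullback_eq, hsc]
    field_simp
  · exact smul_right_injective _ (inv_pos.2 hc).ne' (hf.injOn (hmem p hp) (hmem q hq)
      (smul_right_injective _ hc.ne' hpq))
  · have := hf.mapsTo (hmem p hp) i
    simp only [Pi.smul_apply, Prod.smul_fst, Prod.smul_snd, smul_eq_mul, mul_pow, ← mul_add]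
    exact mul_lt_mul_of_pos_left this (by positivity)

end Embeddings

/-! ### Acting on some of the coordinates only -/

theorem stdSymplecticForm_extend {m n : ℕ} {ι : Fin m → Fin n} (hι : Function.Injective ι)
    (a b : PhaseSpace m) (u v : PhaseSpace n) :
    stdSymplecticForm (Function.extend ι a u) (Function.extend ι b v) =
      stdSymplecticForm a b + (stdSymplecticForm u v - stdSymplecticForm (u ∘ ι) (v ∘ ι)) := by
  classical
  have key : ∀ F : Fin n → ℝ,
      ∑ i, F i = ∑ j, F (ι j) + ∑ i ∈ Finset.univ \ Finset.univ.image ι, F i := by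
    intro F
    rw [← Finset.sum_image (g := ι) (s := Finset.univ) (f := F) (fun x _ y _ h => hι h), add_comm,
      Finset.sum_sdiff (Finset.subset_univ _)]
  simp only [stdSymplecticForm]
  rw [key, key fun i => (u i).1 * (v i).2 - (u i).2 * (v i).1]
  simp only [hι.extend_apply, Function.comp_apply]
  have : ∀ i ∈ Finset.univ \ Finset.univ.image ι,
      (Function.extend ι a u i).1 * (Function.extend ι b v i).2
        - (Function.extend ι a u i).2 * (Function.extend ι b v i).1
      = (u i).1 * (v i).2 - (u i).2 * (v i).1 := by
    intro i hi
    have hi' : ¬ ∃ j, ι j = i := by simpa using hi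
    simp only [Function.extend_apply' _ _ _ hi']
  rw [Finset.sum_congr rfl this]
  ring

theorem SymplecticallyEmbeds.extend {m n : ℕ} {ι : Fin m → Fin n} (hι : Function.Injective ι)
    {R R' : Fin n → ℝ} (hR : ∀ i, (∀ j, ι j ≠ i) → R i = R' i)
    (h : SymplecticallyEmbeds (polydisk (R ∘ ι)) (polydisk (R' ∘ ι))) :
    SymplecticallyEmbeds (polydisk R) (polydisk R') := by
  classical
  obtain ⟨f, hf⟩ := h
  have hmem : ∀ p ∈ polydisk R, p ∘ ι ∈ polydisk (R ∘ ι) := fun p hp j => hp (ι j)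
  refine ⟨fun p => Function.extend ι (f (p ∘ ι)) p, isSymplecticEmbedding_of_injOn
    (isOpen_polydisk _) (fun p hp => ?_) (fun p hp q hq hpq => ?_) (fun p hp i => ?_)⟩
  · have hs := hf.isSymplecticAt (isOpen_polydisk _) (hmem p hp)
    let c : PhaseSpace n →L[ℝ] PhaseSpace m :=
      ContinuousLinearMap.pi fun j => ContinuousLinearMap.proj (ι j)
    have hc : ∀ u, c u = u ∘ ι := fun u => rfl
    refine ⟨contDiffAt_pi.2 fun i => ?_, fun u v => ?_⟩
    · by_cases hi : ∃ j, ι j = i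
      · obtain ⟨j, rfl⟩ := hi
        simp only [hι.extend_apply]
        exact contDiffAt_pi.1 (hs.contDiffAt.comp p c.contDiff.contDiffAt) j
      · simp only [Function.extend_apply' _ _ _ hi]
        fun_prop
    · have hd : ∀ u, fderiv ℝ (fun p => Function.extend ι (f (p ∘ ι)) p) p u
          = Function.extend ι (fderiv ℝ f (p ∘ ι) (u ∘ ι)) u := by
        intro u
        have hfc : HasFDerivAt (fun p => f (p ∘ ι)) ((fderiv ℝ f (p ∘ ι)).comp c) p :=
          hs.differentiableAt.hasFDerivAt.comp p c.hasFDerivAt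
        let D : Fin n → PhaseSpace n →L[ℝ] ℝ × ℝ := fun i =>
          Function.extend ι (fun j => (ContinuousLinearMap.proj j).comp
            ((fderiv ℝ f (p ∘ ι)).comp c)) (fun i => ContinuousLinearMap.proj i) i
        have hD : HasFDerivAt (fun p => Function.extend ι (f (p ∘ ι)) p)
            (ContinuousLinearMap.pi D) p := by
          refine hasFDerivAt_pi.2 fun i => ?_
          by_cases hi : ∃ j, ι j = i
          · obtain ⟨j, rfl⟩ := hi
            simp only [hι.extend_apply, D]
            exact hasFDerivAt_pi'.1 hfc j
          · simp only [Function.extend_apply' _ _ _ hi, D]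
            exact hasFDerivAt_apply i p
        rw [hD.fderiv]
        funext i
        simp only [ContinuousLinearMap.pi_apply, D]
        by_cases hi : ∃ j, ι j = i
        · obtain ⟨j, rfl⟩ := hi
          simp only [hι.extend_apply]
          rfl
        · simp only [Function.extend_apply' _ _ _ hi]
          rfl
      rw [hd, hd, stdSymplecticForm_extend hι, hs.pullback_eq]
      ring
  · have hpq' : Function.extend ι (f (p ∘ ι)) p = Function.extend ι (f (q ∘ ι)) q := hpq
    have h1 : f (p ∘ ι) = f (q ∘ ι) := by
      funext j
      simpa only [hι.extend_apply] using congrFun hpq' (ι j)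
    have h2 := hf.injOn (hmem p hp) (hmem q hq) h1
    funext i
    by_cases hi : ∃ j, ι j = i
    · obtain ⟨j, rfl⟩ := hi
      exact congrFun h2 j
    · simpa only [Function.extend_apply' _ _ _ hi] using congrFun hpq' i
  · by_cases hi : ∃ j, ι j = i
    · obtain ⟨j, rfl⟩ := hi
      simp only [hι.extend_apply]
      exact hf.mapsTo (hmem p hp) j
    · simp only [Function.extend_apply' _ _ _ hi]
      rw [← hR i (by simpa using hi)]
      exact hp i

/-! ### Products of area preserving planar maps -/

/-- `φ` is smooth at `z` and preserves the area form there. -/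
structure IsAreaPreservingAt (φ : ℝ × ℝ → ℝ × ℝ) (z : ℝ × ℝ) : Prop where
  contDiffAt : ContDiffAt ℝ ∞ φ z
  det_eq : ∀ u v : ℝ × ℝ, (fderiv ℝ φ z u).1 * (fderiv ℝ φ z v).2
    - (fderiv ℝ φ z u).2 * (fderiv ℝ φ z v).1 = u.1 * v.2 - u.2 * v.1

theorem IsAreaPreservingAt.of_components {φ : ℝ × ℝ → ℝ × ℝ} {z : ℝ × ℝ} {A B : ℝ × ℝ →L[ℝ] ℝ}
    (hφ : ContDiffAt ℝ ∞ φ z) (hA : HasFDerivAt (fun w => (φ w).1) A z)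
    (hB : HasFDerivAt (fun w => (φ w).2) B z)
    (h : ∀ u v, A u * B v - B u * A v = u.1 * v.2 - u.2 * v.1) : IsAreaPreservingAt φ z where
  contDiffAt := hφ
  det_eq u v := by
    have hd : HasFDerivAt φ (A.prod B) z := hA.prodMk hB
    rw [hd.fderiv]
    exact h u v

theorem isAreaPreservingAt_id (z : ℝ × ℝ) : IsAreaPreservingAt id z :=
  ⟨contDiffAt_id, by simp⟩

theorem IsSymplecticAt.pi {n : ℕ} {φ : Fin n → ℝ × ℝ → ℝ × ℝ} {p : PhaseSpace n}
    (h : ∀ i, IsAreaPreservingAt (φ i) (p i)) : IsSymplecticAt (fun q i => φ i (q i)) p where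
  contDiffAt := contDiffAt_pi.2 fun i =>
    (h i).contDiffAt.comp p (g := φ i) (f := fun q => q i) (by fun_prop)
  pullback_eq u v := by
    have hd : HasFDerivAt (fun (q : PhaseSpace n) i => φ i (q i))
        (ContinuousLinearMap.pi fun i => (fderiv ℝ (φ i) (p i)).comp
          (ContinuousLinearMap.proj i)) p :=
      hasFDerivAt_pi.2 fun i => ((h i).contDiffAt.differentiableAt
        (by simp)).hasFDerivAt.comp p (hasFDerivAt_apply i p)
    rw [hd.fderiv]
    exact Finset.sum_congr rfl fun i _ => (h i).det_eq (u i) (v i)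

/-- The affine map stretching the first coordinate by `a` and the second by `a⁻¹`. -/
noncomputable def stretch (a b c : ℝ) (z : ℝ × ℝ) : ℝ × ℝ := (a * z.1 + b, a⁻¹ * z.2 + c)

theorem isAreaPreservingAt_stretch {a : ℝ} (ha : a ≠ 0) (b c : ℝ) (z : ℝ × ℝ) :
    IsAreaPreservingAt (stretch a b c) z := by
  refine .of_components (A := a • ContinuousLinearMap.fst ℝ ℝ ℝ)
    (B := a⁻¹ • ContinuousLinearMap.snd ℝ ℝ ℝ) ?_ ?_ ?_ fun u v => ?_
  · unfold stretch; fun_prop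
  · exact (hasFDerivAt_fst.const_mul a).add_const b
  · exact (hasFDerivAt_snd.const_mul a⁻¹).add_const c
  · simp only [ContinuousLinearMap.coe_fst', ContinuousLinearMap.coe_snd', smul_apply, smul_eq_mul]
    field_simp

theorem stretch_injective {a : ℝ} (ha : a ≠ 0) (b c : ℝ) :
    Function.Injective (stretch a b c) := by
  intro z w h
  simp only [stretch, Prod.mk.injEq, add_left_inj] at h
  exact Prod.ext (mul_left_cancel₀ ha h.1) (mul_left_cancel₀ (inv_ne_zero ha) h.2)

theorem abs_stretch_sub_lt {a b c r : ℝ} {z : ℝ × ℝ} (ha : 0 < a)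
    (h : z.1 ^ 2 + z.2 ^ 2 < r ^ 2) (hr : 0 < r) :
    |(stretch a b c z).1 - b| < a * r ∧ |(stretch a b c z).2 - c| < a⁻¹ * r := by
  have h1 : |z.1| < r := abs_lt_of_sq_lt_sq (by nlinarith [sq_nonneg z.2]) hr.le
  have h2 : |z.2| < r := abs_lt_of_sq_lt_sq (by nlinarith [sq_nonneg z.1]) hr.le
  have ha' := inv_pos.2 ha
  simp only [stretch, add_sub_cancel_right, abs_mul, abs_of_pos ha, abs_of_pos ha']
  exact ⟨mul_lt_mul_of_pos_left h1 ha, mul_lt_mul_of_pos_left h2 ha'⟩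

/-- Polar coordinates centred at `(-c, 0)`, with the radius replaced by half its square. -/
noncomputable def polar (c : ℝ) (z : ℝ × ℝ) : ℝ × ℝ :=
  (√(2 * z.1) * Real.cos z.2 - c, √(2 * z.1) * Real.sin z.2)

theorem isAreaPreservingAt_polar (c : ℝ) {z : ℝ × ℝ} (hz : 0 < z.1) :
    IsAreaPreservingAt (polar c) z := by
  have h0 : 2 * z.1 ≠ 0 := by positivity
  have hs : HasFDerivAt (fun w : ℝ × ℝ => √(2 * w.1))
      ((1 / (2 * √(2 * z.1))) • (2 : ℝ) • ContinuousLinearMap.fst ℝ ℝ ℝ) z :=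
    (hasFDerivAt_fst.const_mul (2 : ℝ)).sqrt h0
  have hcd : ContDiffAt ℝ ∞ (fun w : ℝ × ℝ => √(2 * w.1)) z :=
    ContDiffAt.sqrt (by fun_prop) h0
  refine .of_components ?_ ((hs.mul (hasFDerivAt_snd.cos)).sub_const c)
    (hs.mul (hasFDerivAt_snd.sin)) fun u v => ?_
  · unfold polar
    exact ((hcd.mul (by fun_prop)).sub contDiffAt_const).prodMk (hcd.mul (by fun_prop))
  · have : √(2 * z.1) ≠ 0 := (Real.sqrt_pos.2 (by positivity)).ne'
    simp only [ContinuousLinearMap.coe_fst', ContinuousLinearMap.coe_snd', smul_apply, smul_eq_mul,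
      add_apply]
    field_simp
    linear_combination √(2 * z.1) ^ 2 * (u.1 * v.2 - u.2 * v.1) * Real.sin_sq_add_cos_sq z.2

theorem polar_sq_add_sq (c : ℝ) {z : ℝ × ℝ} (hz : 0 ≤ z.1) :
    ((polar c z).1 + c) ^ 2 + (polar c z).2 ^ 2 = 2 * z.1 := by
  have := Real.sq_sqrt (show 0 ≤ 2 * z.1 by positivity)
  simp only [polar]
  linear_combination (√(2 * z.1)) ^ 2 * Real.sin_sq_add_cos_sq z.2 + this

theorem polar_eq_polar {c : ℝ} {z w : ℝ × ℝ} (hz : 0 < z.1) (hw : 0 < w.1)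
    (h : polar c z = polar c w) : z.1 = w.1 ∧ ∃ k : ℤ, z.2 = w.2 + k * (2 * Real.pi) := by
  have h1 : z.1 = w.1 := by
    have hz' := polar_sq_add_sq c hz.le
    have hw' := polar_sq_add_sq c hw.le
    rw [h] at hz'
    linarith
  refine ⟨h1, ?_⟩
  simp only [polar, h1, Prod.mk.injEq, sub_left_inj] at h
  have hne : √(2 * w.1) ≠ 0 := (Real.sqrt_pos.2 (by positivity)).ne'
  have hc := mul_left_cancel₀ hne h.1
  have hs := mul_left_cancel₀ hne h.2
  have : Real.cos (z.2 - w.2) = 1 := by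
    rw [Real.cos_sub, hc, hs]
    linear_combination Real.sin_sq_add_cos_sq w.2
  obtain ⟨k, hk⟩ := (Real.cos_eq_one_iff _).1 this
  exact ⟨k, by linarith⟩

/-! ### Wrapping a product of rectangles around a torus -/

/-- A linear shear of `ℝ⁴` which makes a long strip in the second factor wrap around a torus. -/
noncomputable def wrapShear (N : ℝ) (p : PhaseSpace 2) : PhaseSpace 2 :=
  ![((p 0).1, (p 0).2 + (p 1).2 / N), ((p 1).1 - (p 0).1 / N, (p 1).2)]

theorem isSymplecticAt_wrapShear (N : ℝ) (p : PhaseSpace 2) :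
    IsSymplecticAt (wrapShear N) p := by
  let x : Fin 2 → PhaseSpace 2 →L[ℝ] ℝ := fun i =>
    (ContinuousLinearMap.fst ℝ ℝ ℝ).comp (ContinuousLinearMap.proj i)
  let y : Fin 2 → PhaseSpace 2 →L[ℝ] ℝ := fun i =>
    (ContinuousLinearMap.snd ℝ ℝ ℝ).comp (ContinuousLinearMap.proj i)
  have hx : ∀ i, HasFDerivAt (fun q : PhaseSpace 2 => (q i).1) (x i) p := fun i =>
    (x i).hasFDerivAt
  have hy : ∀ i, HasFDerivAt (fun q : PhaseSpace 2 => (q i).2) (y i) p := fun i =>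
    (y i).hasFDerivAt
  refine .of_components (A := ![x 0, x 1 - N⁻¹ • x 0]) (B := ![y 0 + N⁻¹ • y 1, y 1])
    ?_ ?_ ?_ fun u v => ?_
  · refine contDiffAt_pi.2 ?_
    rw [Fin.forall_fin_two]
    simp only [wrapShear, Matrix.cons_val_zero, Matrix.cons_val_one]
    constructor <;> fun_prop
  · rw [Fin.forall_fin_two]
    simp only [wrapShear, Matrix.cons_val_zero, Matrix.cons_val_one, div_eq_inv_mul]
    exact ⟨hx 0, (hx 1).sub ((hx 0).const_mul _)⟩
  · rw [Fin.forall_fin_two]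
    simp only [wrapShear, Matrix.cons_val_zero, Matrix.cons_val_one, div_eq_inv_mul]
    exact ⟨(hy 0).add ((hy 1).const_mul _), hy 1⟩
  · simp [x, y, stdSymplecticForm, Fin.sum_univ_two]
    ring

/-- Here `d` is a difference of angles in the first factor and `k` a difference of winding numbers
in the second. The equation makes `d` a multiple of 2π/N smaller than one step, so `d = 0`; then N
divides `k`. -/
theorem abs_add_int_mul_lt {d N : ℝ} {m : ℤ} {k l : ℤ} (hN : (m : ℝ) = N) (hm : 0 < m)
    (hd : |d| < 2 * Real.pi / N) (hk : |(k : ℝ)| < N)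
    (h : d + k * (2 * Real.pi) / N = l * (2 * Real.pi)) : k = 0 ∧ d = 0 := by
  subst hN
  have hpi := Real.pi_pos
  have hm' : (0 : ℝ) < m := by exact_mod_cast hm
  have hd1 : d = (l * m - k : ℤ) * (2 * Real.pi / m) := by
    push_cast; field_simp; field_simp at h; linarith
  have h0 : l * m - k = 0 := by
    rw [hd1, abs_mul, abs_of_pos (show 0 < 2 * Real.pi / (m : ℝ) by positivity)] at hd
    have : |((l * m - k : ℤ) : ℝ)| < 1 := by
      by_contra hcon
      push Not at hcon
      exact absurd hd (not_lt.2 (le_mul_of_one_le_left (by positivity) hcon))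
    have h2 : |l * m - k| < 1 := by exact_mod_cast this
    exact Int.abs_lt_one_iff.1 h2
  have hk' : |k| < m := by exact_mod_cast hk
  refine ⟨?_, by rw [hd1, h0]; simp⟩
  refine Int.eq_zero_of_abs_lt_dvd (m := m) ⟨l, by linarith⟩ hk'

/-- The strip in the second factor, of length 2πN, winds N times. Each turn rotates the first factor
by 2π/N, the angular width of the sector it occupies, so the turns are disjoint. -/
theorem embeds_wrap {a b : ℝ} {N : ℕ} (ha : 0 < a) (hb : 0 < b) (hN : 0 < N)
    (h : a ^ 2 * N ≤ b ^ 2) :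
    SymplecticallyEmbeds (polydisk ![a, b]) (polydisk ![2 * a * √N, 2 * b / √N]) := by
  have hpi := Real.pi_pos
  have hN' : (0 : ℝ) < N := by exact_mod_cast hN
  -- The discs go into (0, 2Na²/π) × (-π/N, π/N) and an interval times (-Nπ, Nπ). The extra offset
  -- 2a²/π keeps the second radial coordinate positive after the shear, which lowers it by less than
  -- that amount.
  set S : PhaseSpace 2 → PhaseSpace 2 := fun p i =>
    (![stretch (N * a / Real.pi) (N * a ^ 2 / Real.pi) 0,
      stretch (b / (Real.pi * N)) (b ^ 2 / (Real.pi * N) + 2 * a ^ 2 / Real.pi) 0] :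
        Fin 2 → ℝ × ℝ → ℝ × ℝ) i (p i) with hS
  set P : PhaseSpace 2 → PhaseSpace 2 := fun p i => polar 0 (p i) with hP
  have hrange : ∀ p ∈ polydisk ![a, b], ∀ ρ r τ t : ℝ, S p = ![(ρ, r), (τ, t)] →
      (0 < ρ ∧ ρ < 2 * N * a ^ 2 / Real.pi) ∧ |r| < Real.pi / N ∧
      (2 * a ^ 2 / Real.pi < τ ∧ τ < 2 * b ^ 2 / (Real.pi * N) + 2 * a ^ 2 / Real.pi) ∧
      |t| < N * Real.pi := by
    intro p hp ρ r τ t hpt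
    have e0 := congrFun hpt 0
    have e1 := congrFun hpt 1
    have h0 := abs_stretch_sub_lt (r := a) (a := N * a / Real.pi) (b := N * a ^ 2 / Real.pi) (c := 0)
      (by positivity) (hp 0) ha
    have h1 := abs_stretch_sub_lt (r := b) (a := b / (Real.pi * N))
      (b := b ^ 2 / (Real.pi * N) + 2 * a ^ 2 / Real.pi) (c := 0) (by positivity) (hp 1) hb
    have e0' : stretch (N * a / Real.pi) (N * a ^ 2 / Real.pi) 0 (p 0) = (ρ, r) := e0
    have e1' : stretch (b / (Real.pi * N)) (b ^ 2 / (Real.pi * N) + 2 * a ^ 2 / Real.pi) 0 (p 1)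
      = (τ, t) := e1
    have w0 : N * a / Real.pi * a = N * a ^ 2 / Real.pi := by ring
    have w1 : (N * a / Real.pi)⁻¹ * a = Real.pi / N := by field_simp
    have w2 : b / (Real.pi * N) * b = b ^ 2 / (Real.pi * N) := by ring
    have w3 : (b / (Real.pi * N))⁻¹ * b = N * Real.pi := by field_simp
    have w4 : 2 * N * a ^ 2 / Real.pi = N * a ^ 2 / Real.pi + N * a ^ 2 / Real.pi := by ring
    have w5 : 2 * b ^ 2 / (Real.pi * N) = b ^ 2 / (Real.pi * N) + b ^ 2 / (Real.pi * N) := by ring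
    rw [e0', sub_zero, w0, w1, abs_lt] at h0
    rw [e1', sub_zero, w2, w3, abs_lt] at h1
    obtain ⟨⟨h0a, h0b⟩, h0c⟩ := h0
    obtain ⟨⟨h1a, h1b⟩, h1c⟩ := h1
    dsimp only at h0a h0b h0c h1a h1b h1c
    exact ⟨⟨by linarith, by linarith⟩, h0c, ⟨by linarith, by linarith⟩, h1c⟩
  have hpair : ∀ q : PhaseSpace 2, q = ![((q 0).1, (q 0).2), ((q 1).1, (q 1).2)] := by
    intro q; funext i; fin_cases i <;> rfl
  have hbound : ∀ p ∈ polydisk ![a, b], (0 < (wrapShear N (S p) 0).1 ∧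
      (wrapShear N (S p) 0).1 < 2 * N * a ^ 2 / Real.pi) ∧ 0 < (wrapShear N (S p) 1).1 ∧
      (wrapShear N (S p) 1).1 < 2 * b ^ 2 / (Real.pi * N) + 2 * a ^ 2 / Real.pi := by
    intro p hp
    obtain ⟨⟨h1, h2⟩, -, ⟨h3, h4⟩, -⟩ := hrange p hp _ _ _ _ (hpair (S p))
    simp only [wrapShear, Matrix.cons_val_zero, Matrix.cons_val_one]
    have h5 : 0 < (S p 0).1 / N := by positivity
    have h6 : (S p 0).1 / N < 2 * a ^ 2 / Real.pi := by
      rw [div_lt_iff₀ hN']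
      calc _ < _ := h2
        _ = _ := by ring
    exact ⟨⟨h1, h2⟩, by linarith, by linarith⟩
  refine ⟨P ∘ wrapShear N ∘ S, isSymplecticEmbedding_of_injOn (isOpen_polydisk _)
    (fun p hp => ?_) (fun p hp q hq hpq => ?_) (fun p hp => ?_)⟩
  · refine IsSymplecticAt.comp (.pi fun i => isAreaPreservingAt_polar 0 ?_)
      ((isSymplecticAt_wrapShear _ _).comp (.pi fun i => ?_))
    · have := hbound p hp
      fin_cases i
      · exact this.1.1
      · exact this.2.1
    · fin_cases i
      · exact isAreaPreservingAt_stretch (by positivity) _ _ _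
      · exact isAreaPreservingAt_stretch (by positivity) _ _ _
  · have hb1 := hbound p hp
    have hb2 := hbound q hq
    obtain ⟨e1, l, hl⟩ := polar_eq_polar hb1.1.1 hb2.1.1 (congrFun hpq 0)
    obtain ⟨e2, k, hk⟩ := polar_eq_polar hb1.2.1 hb2.2.1 (congrFun hpq 1)
    simp only [wrapShear, Matrix.cons_val_zero, Matrix.cons_val_one] at e1 hl e2 hk
    obtain ⟨-, hr, -, ht⟩ := hrange p hp _ _ _ _ (hpair (S p))
    obtain ⟨-, hr', -, ht'⟩ := hrange q hq _ _ _ _ (hpair (S q))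
    rw [e1, sub_left_inj] at e2
    rw [hk] at hl
    obtain ⟨hk0, hd0⟩ := abs_add_int_mul_lt (d := (S p 0).2 - (S q 0).2) (N := N) (m := N)
      (k := k) (l := l) (by simp) (by exact_mod_cast hN) (by
        rw [abs_lt] at hr hr' ⊢
        have : 2 * Real.pi / N = Real.pi / N + Real.pi / N := by ring
        constructor <;> linarith) (by
        have h1 : |(k : ℝ) * (2 * Real.pi)| < N * (2 * Real.pi) := by
          have : (k : ℝ) * (2 * Real.pi) = (S p 1).2 - (S q 1).2 := by linarith
          rw [this]
          rw [abs_lt] at ht ht' ⊢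
          constructor <;> linarith
        rw [abs_mul, abs_of_pos (show 0 < 2 * Real.pi by positivity)] at h1
        exact lt_of_mul_lt_mul_right h1 (by positivity)) (by
        rw [add_div] at hl; linarith)
    have hSS : S p = S q := by
      funext i
      fin_cases i
      · exact Prod.ext e1 (by simpa [sub_eq_zero] using hd0)
      · exact Prod.ext e2 (by simpa [hk0] using hk)
    funext i
    have := congrFun hSS i
    fin_cases i
    · exact stretch_injective (by positivity) _ _ this
    · exact stretch_injective (by positivity) _ _ this
  · obtain ⟨⟨h1, h2⟩, h3, h4⟩ := hbound p hp
    have g1 := polar_sq_add_sq 0 h1.le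
    have g2 := polar_sq_add_sq 0 h3.le
    rw [add_zero] at g1 g2
    have hpi3 := Real.pi_gt_three
    intro i
    fin_cases i
    · change (polar 0 (wrapShear N (S p) 0)).1 ^ 2 + (polar 0 (wrapShear N (S p) 0)).2 ^ 2
        < (2 * a * √N) ^ 2
      rw [g1, mul_pow, Real.sq_sqrt hN'.le]
      have : 2 * N * a ^ 2 / Real.pi ≤ 2 * N * a ^ 2 := div_le_self (by positivity) (by linarith)
      nlinarith
    · change (polar 0 (wrapShear N (S p) 1)).1 ^ 2 + (polar 0 (wrapShear N (S p) 1)).2 ^ 2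
        < (2 * b / √N) ^ 2
      rw [g2, div_pow, Real.sq_sqrt hN'.le]
      have k1 : a ^ 2 ≤ b ^ 2 / N := (le_div_iff₀ hN').2 h
      have k2 : 2 * b ^ 2 / (Real.pi * N) = 2 / Real.pi * (b ^ 2 / N) := by field_simp
      have k3 : 2 * a ^ 2 / Real.pi = 2 / Real.pi * a ^ 2 := by ring
      have k4 : 2 / Real.pi ≤ 2 / 3 := by gcongr
      have k5 : 0 < b ^ 2 / N := by positivity
      have k6 : (2 * b) ^ 2 / N = 4 * (b ^ 2 / N) := by ring
      have k7 : 2 / Real.pi * a ^ 2 ≤ 2 / Real.pi * (b ^ 2 / N) := by gcongr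
      have k8 : 2 / Real.pi * (b ^ 2 / N) ≤ 2 / 3 * (b ^ 2 / N) := by gcongr
      rw [k6]
      linarith

theorem exists_embeds_fold : ∃ C : ℝ, 1 ≤ C ∧ ∀ a b s : ℝ, 0 < a → 1 ≤ s → a * s ≤ b →
    SymplecticallyEmbeds (polydisk ![a, b]) (polydisk ![C * (a * s), C * (b / s)]) := by
  refine ⟨4, by norm_num, fun a b s ha hs h => ?_⟩
  have hb : 0 < b := by nlinarith
  have hs0 : 0 < s := by linarith
  -- This choice gives s/2 ≤ √N ≤ s, so rounding costs only a constant.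
  set N := ⌊s ^ 2⌋₊ with hNdef
  have hN1 : 1 ≤ N := Nat.one_le_floor_iff _ |>.2 (by nlinarith)
  have hN1' : (1 : ℝ) ≤ N := by exact_mod_cast hN1
  have hNle : (N : ℝ) ≤ s ^ 2 := Nat.floor_le (by positivity)
  have hNlt : s ^ 2 < N + 1 := Nat.lt_floor_add_one _
  have hsq : √N ≤ s := Real.sqrt_le_left hs0.le |>.2 hNle
  have hsq' : s / 2 ≤ √N := Real.le_sqrt_of_sq_le (by nlinarith)
  refine (embeds_wrap ha hb hN1 ?_).trans (isOpen_polydisk _) (isOpen_polydisk _)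
    (SymplecticallyEmbeds.of_subset (isOpen_polydisk _) (polydisk_subset ?_ ?_))
  · calc a ^ 2 * N ≤ a ^ 2 * s ^ 2 := by gcongr
      _ = (a * s) ^ 2 := by ring
      _ ≤ b ^ 2 := by gcongr
  · rw [Fin.forall_fin_two]
    simp only [Matrix.cons_val_zero, Matrix.cons_val_one]
    constructor <;> positivity
  · rw [Fin.forall_fin_two]
    simp only [Matrix.cons_val_zero, Matrix.cons_val_one]
    constructor
    · nlinarith [mul_le_mul_of_nonneg_left hsq ha.le, mul_pos ha hs0]
    · calc 2 * b / √N ≤ 2 * b / (s / 2) := by gcongr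
        _ = 4 * (b / s) := by field_simp; norm_num

/-! ### Cut-off functions -/

theorem deriv_smoothTransition_of_nonpos {x : ℝ} (hx : x ≤ 0) :
    deriv Real.smoothTransition x = 0 :=
  IsLocalMin.deriv_eq_zero <| Filter.Eventually.of_forall fun y => by
    rw [Real.smoothTransition.zero_of_nonpos hx]; exact Real.smoothTransition.nonneg y

theorem deriv_smoothTransition_of_one_le {x : ℝ} (hx : 1 ≤ x) :
    deriv Real.smoothTransition x = 0 :=
  IsLocalMax.deriv_eq_zero <| Filter.Eventually.of_forall fun y => by
    rw [Real.smoothTransition.one_of_one_le hx]; exact Real.smoothTransition.le_one y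

/-- A smooth function of the squared distance to the origin, stepping from `0` to `1`. -/
noncomputable def radialStep (s : ℝ) : ℝ := Real.smoothTransition (s - 3 / 2)

theorem contDiff_radialStep : ContDiff ℝ ∞ radialStep :=
  Real.smoothTransition.contDiff.comp (contDiff_id.sub contDiff_const)

theorem contDiff_deriv_radialStep : ContDiff ℝ ∞ (deriv radialStep) :=
  (contDiff_infty_iff_deriv.1 contDiff_radialStep).2

theorem deriv_radialStep (s : ℝ) :
    deriv radialStep s = deriv Real.smoothTransition (s - 3 / 2) :=
  deriv_comp_sub_const (f := Real.smoothTransition) (3 / 2) s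

theorem radialStep_of_le {s : ℝ} (hs : s ≤ 3 / 2) : radialStep s = 0 ∧ deriv radialStep s = 0 :=
  ⟨Real.smoothTransition.zero_of_nonpos (by linarith),
    (deriv_radialStep s).trans (deriv_smoothTransition_of_nonpos (by linarith))⟩

theorem radialStep_of_ge {s : ℝ} (hs : 5 / 2 ≤ s) : radialStep s = 1 ∧ deriv radialStep s = 0 :=
  ⟨Real.smoothTransition.one_of_one_le (by linarith),
    (deriv_radialStep s).trans (deriv_smoothTransition_of_one_le (by linarith))⟩

/-- A smooth periodic function vanishing on the upper half circle, which is `1` on an arc of the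
lower half circle. -/
noncomputable def lowerBump (y : ℝ) : ℝ := Real.smoothTransition (-2 * Real.sin y)

theorem contDiff_lowerBump : ContDiff ℝ ∞ lowerBump :=
  Real.smoothTransition.contDiff.comp (contDiff_const.mul Real.contDiff_sin)

theorem contDiff_deriv_lowerBump : ContDiff ℝ ∞ (deriv lowerBump) :=
  (contDiff_infty_iff_deriv.1 contDiff_lowerBump).2

theorem lowerBump_of_sin_nonneg {y : ℝ} (h : 0 ≤ Real.sin y) : lowerBump y = 0 :=
  Real.smoothTransition.zero_of_nonpos (by linarith)

theorem lowerBump_of_sin_le {y : ℝ} (h : Real.sin y ≤ -1 / 2) : lowerBump y = 1 :=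
  Real.smoothTransition.one_of_one_le (by linarith)

/-- Periodicity makes the bound uniform along arbitrarily long strips; it determines how thin the
first factor must be. -/
theorem exists_abs_deriv_lowerBump_le : ∃ M : ℝ, 0 < M ∧ ∀ y, |deriv lowerBump y| ≤ M := by
  have hper : Function.Periodic (deriv lowerBump) (2 * Real.pi) := by
    intro y
    rw [← deriv_comp_add_const]
    congr 1
    funext z
    simp [lowerBump]
  obtain ⟨M, hM, h⟩ := (hper.isBounded_of_continuous Real.two_pi_pos.ne'
    contDiff_deriv_lowerBump.continuous).exists_pos_norm_le
  exact ⟨M, hM, fun y => h _ ⟨y, rfl⟩⟩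

/-! ### The building blocks of the squeezing map -/

/-- Shift the first factor by `lowerBump` of the second coordinate of the second factor. -/
noncomputable def lift (p : PhaseSpace 3) : PhaseSpace 3 :=
  ![((p 0).1 + lowerBump (p 1).2, (p 0).2),
    ((p 1).1 + (p 0).2 * deriv lowerBump (p 1).2, (p 1).2), p 2]

/-- The time one map of the Hamiltonian `v * radialStep (a ^ 2 + b ^ 2)`, where `(a, b)` and
`(u, v)` are the second and the third factor, followed by a translation of `u`. -/
noncomputable def twist (k : ℝ) (p : PhaseSpace 3) : PhaseSpace 3 :=
  let s := (p 1).1 ^ 2 + (p 1).2 ^ 2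
  let φ := 2 * (p 2).2 * deriv radialStep s
  ![p 0, ((p 1).1 * Real.cos φ + (p 1).2 * Real.sin φ, (p 1).2 * Real.cos φ - (p 1).1 * Real.sin φ),
    ((p 2).1 + k + radialStep s, (p 2).2)]

/-- Translation of the third factor. -/
def shift (k : ℝ) (p : PhaseSpace 3) : PhaseSpace 3 :=
  ![p 0, p 1, ((p 2).1 + k, (p 2).2)]

theorem hasFDerivAt_coord_fst {n : ℕ} (i : Fin n) (p : PhaseSpace n) :
    HasFDerivAt (fun q : PhaseSpace n => (q i).1) ((ContinuousLinearMap.fst ℝ ℝ ℝ).comp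
      (ContinuousLinearMap.proj (R := ℝ) (φ := fun _ : Fin n => ℝ × ℝ) i)) p :=
  ((ContinuousLinearMap.fst ℝ ℝ ℝ).comp
      (ContinuousLinearMap.proj (R := ℝ) (φ := fun _ : Fin n => ℝ × ℝ) i)).hasFDerivAt

theorem hasFDerivAt_coord_snd {n : ℕ} (i : Fin n) (p : PhaseSpace n) :
    HasFDerivAt (fun q : PhaseSpace n => (q i).2) ((ContinuousLinearMap.snd ℝ ℝ ℝ).comp
      (ContinuousLinearMap.proj (R := ℝ) (φ := fun _ : Fin n => ℝ × ℝ) i)) p :=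
  ((ContinuousLinearMap.snd ℝ ℝ ℝ).comp
      (ContinuousLinearMap.proj (R := ℝ) (φ := fun _ : Fin n => ℝ × ℝ) i)).hasFDerivAt

theorem forall_fin_three {P : Fin 3 → Prop} : (∀ i, P i) ↔ P 0 ∧ P 1 ∧ P 2 :=
  ⟨fun h => ⟨h 0, h 1, h 2⟩, fun h i => by
    fin_cases i
    exacts [h.1, h.2.1, h.2.2]⟩

/-- `lift` is the time one map of the Hamiltonian y₀ · `lowerBump` y₁. -/
theorem isSymplecticAt_lift (p : PhaseSpace 3) : IsSymplecticAt lift p := by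
  have hx := fun i => hasFDerivAt_coord_fst i p
  have hy := fun i => hasFDerivAt_coord_snd i p
  have hχ : HasDerivAt lowerBump (deriv lowerBump (p 1).2) (p 1).2 :=
    (contDiff_lowerBump.differentiable (by simp) _).hasDerivAt
  have hχ' : HasDerivAt (deriv lowerBump) (deriv (deriv lowerBump) (p 1).2) (p 1).2 :=
    (contDiff_deriv_lowerBump.differentiable (by simp) _).hasDerivAt
  have e1 := (hx 0).add (hχ.comp_hasFDerivAt p (hy 1))
  have e2 := (hx 1).add ((hy 0).mul (hχ'.comp_hasFDerivAt p (hy 1)))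
  refine .of_components (A := ![_, _, _]) (B := ![_, _, _]) ?_ (forall_fin_three.2 ⟨e1, e2, hx 2⟩)
    (forall_fin_three.2 ⟨hy 0, hy 1, hy 2⟩) fun u v => ?_
  · refine contDiffAt_pi.2 (forall_fin_three.2 ?_)
    have c1 := contDiff_lowerBump
    have c2 := contDiff_deriv_lowerBump
    simp only [lift, Matrix.cons_val]
    refine ⟨?_, ?_, ?_⟩ <;> fun_prop
  · simp [stdSymplecticForm, Fin.sum_univ_three]
    ring

theorem isSymplecticAt_shift (k : ℝ) (p : PhaseSpace 3) : IsSymplecticAt (shift k) p := by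
  have hx := fun i => hasFDerivAt_coord_fst i p
  have hy := fun i => hasFDerivAt_coord_snd i p
  refine .of_components (A := ![_, _, _]) (B := ![_, _, _]) ?_
    (forall_fin_three.2 ⟨hx 0, hx 1, (hx 2).add_const k⟩)
    (forall_fin_three.2 ⟨hy 0, hy 1, hy 2⟩) fun u v => ?_
  · refine contDiffAt_pi.2 (forall_fin_three.2 ?_)
    simp only [shift, Matrix.cons_val]
    refine ⟨?_, ?_, ?_⟩ <;> fun_prop
  · simp [stdSymplecticForm, Fin.sum_univ_three]

theorem isSymplecticAt_twist (k : ℝ) (p : PhaseSpace 3) : IsSymplecticAt (twist k) p := by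
  have hx := fun i => hasFDerivAt_coord_fst i p
  have hy := fun i => hasFDerivAt_coord_snd i p
  set s := (p 1).1 ^ 2 + (p 1).2 ^ 2 with hs
  have hg : HasDerivAt radialStep (deriv radialStep s) s :=
    (contDiff_radialStep.differentiable (by simp) _).hasDerivAt
  have hg' : HasDerivAt (deriv radialStep) (deriv (deriv radialStep) s) s :=
    (contDiff_deriv_radialStep.differentiable (by simp) _).hasDerivAt
  have es := ((hx 1).pow 2).add ((hy 1).pow 2)
  have eφ := ((hy 2).const_mul 2).mul (hg'.comp_hasFDerivAt p es)
  have e1 := ((hx 1).mul eφ.cos).add ((hy 1).mul eφ.sin)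
  have e2 := ((hy 1).mul eφ.cos).sub ((hx 1).mul eφ.sin)
  have e3 := ((hx 2).add_const k).add (hg.comp_hasFDerivAt p es)
  refine .of_components (A := ![_, _, _]) (B := ![_, _, _]) ?_ (forall_fin_three.2 ⟨hx 0, e1, e3⟩)
    (forall_fin_three.2 ⟨hy 0, e2, hy 2⟩) fun u v => ?_
  · refine contDiffAt_pi.2 (forall_fin_three.2 ?_)
    have c1 := contDiff_radialStep
    have c2 := contDiff_deriv_radialStep
    simp only [twist, Matrix.cons_val]
    refine ⟨?_, ?_, ?_⟩ <;> fun_prop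
  · have hcs := Real.sin_sq_add_cos_sq (2 * (p 2).2 * deriv radialStep s)
    simp [stdSymplecticForm, Fin.sum_univ_three, ← hs]
    -- What remains is a polynomial identity in S, K, G, G' modulo K² + S² = 1.
    generalize Real.sin (2 * (p 2).2 * deriv radialStep s) = S at *
    generalize Real.cos (2 * (p 2).2 * deriv radialStep s) = K at *
    generalize deriv radialStep s = G at *
    generalize deriv (deriv radialStep) s = G' at *
    have : K ^ 2 = 1 - S ^ 2 := by linarith
    ring_nf
    simp only [this]
    ring

/-! ### Angles and the two intersecting circles -/

theorem half_le_cos_of_abs_le {x : ℝ} (h : |x| ≤ Real.pi / 3) : 1 / 2 ≤ Real.cos x := by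
  rw [← Real.cos_abs, ← Real.cos_pi_div_three]
  exact Real.cos_le_cos_of_nonneg_of_le_pi (abs_nonneg x) (by linarith [Real.pi_pos]) h

theorem cos_le_neg_half_of_abs_sub_pi_le {x : ℝ} (h : |x - Real.pi| ≤ Real.pi / 3) :
    Real.cos x ≤ -1 / 2 := by
  have := half_le_cos_of_abs_le h
  rw [Real.cos_sub_pi] at this
  linarith

/-- Squared distance from the origin to the image of a point under `polar 1`. -/
noncomputable def polarNormSq (z : ℝ × ℝ) : ℝ := (polar 1 z).1 ^ 2 + (polar 1 z).2 ^ 2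

/-- Law of cosines for the origin, the centre (-1, 0) and the image point. -/
theorem exists_polarNormSq_eq {z : ℝ × ℝ} (hz : |2 * z.1 - 1| < 1 / 4) :
    ∃ r : ℝ, 0 < r ∧ 3 / 4 < r ^ 2 ∧ r ^ 2 < 5 / 4 ∧
      polarNormSq z = r ^ 2 + 1 - 2 * r * Real.cos z.2 := by
  rw [abs_lt] at hz
  refine ⟨√(2 * z.1), Real.sqrt_pos.2 (by linarith), ?_, ?_, ?_⟩
  · rw [Real.sq_sqrt (by linarith)]; linarith
  · rw [Real.sq_sqrt (by linarith)]; linarith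
  · simp only [polarNormSq, polar]
    linear_combination (√(2 * z.1)) ^ 2 * Real.sin_sq_add_cos_sq z.2

/-- The bound is 5/4 + 1 - 3/4, the threshold where `radialStep` starts to vary. -/
theorem polarNormSq_le {z : ℝ × ℝ} (hz : |2 * z.1 - 1| < 1 / 4) (h : 1 / 2 ≤ Real.cos z.2) :
    polarNormSq z ≤ 3 / 2 := by
  obtain ⟨r, h0, h1, h2, e⟩ := exists_polarNormSq_eq hz
  have : 3 / 4 < r := by nlinarith
  rw [e]
  nlinarith

theorem le_polarNormSq {z : ℝ × ℝ} (hz : |2 * z.1 - 1| < 1 / 4) (h : Real.cos z.2 ≤ -1 / 2) :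
    5 / 2 ≤ polarNormSq z := by
  obtain ⟨r, h0, h1, h2, e⟩ := exists_polarNormSq_eq hz
  have : 3 / 4 < r := by nlinarith
  rw [e]
  nlinarith

theorem polarNormSq_lt {z : ℝ × ℝ} (hz : |2 * z.1 - 1| < 1 / 4) : polarNormSq z < 9 := by
  obtain ⟨r, h0, h1, h2, e⟩ := exists_polarNormSq_eq hz
  have : r < 5 / 4 := by nlinarith
  rw [e]
  nlinarith [Real.neg_one_le_cos z.2]

theorem sin_sq_gt_of_polarNormSq {z : ℝ × ℝ} (hz : |2 * z.1 - 1| < 1 / 4)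
    (h1 : 3 / 2 < polarNormSq z) (h2 : polarNormSq z < 5 / 2) : 1 / 4 < Real.sin z.2 ^ 2 := by
  have c1 : Real.cos z.2 < 1 / 2 := lt_of_not_ge fun h => absurd (polarNormSq_le hz h) (not_le.2 h1)
  have c2 : -1 / 2 < Real.cos z.2 :=
    lt_of_not_ge fun h => absurd (le_polarNormSq hz h) (not_le.2 h2)
  nlinarith [Real.sin_sq_add_cos_sq z.2]

/-! ### Squeezing a long strip along an immersed punctured torus -/

/-- Lift and then map the second factor to an annulus. -/
noncomputable def liftPolar (p : PhaseSpace 3) : PhaseSpace 3 :=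
  ![lift p 0, polar 1 (lift p 1), lift p 2]

/-- The strip in the second factor runs around the annulus; each time it crosses the upper half it
is twisted around the origin. -/
noncomputable def squeeze (p : PhaseSpace 3) : PhaseSpace 3 :=
  if 0 ≤ Real.sin (p 1).2 then twist ⌊(p 1).2 / (2 * Real.pi)⌋ (liftPolar p)
  else shift (⌊(p 1).2 / (2 * Real.pi)⌋ + 1) (liftPolar p)

/-- The domain on which `squeeze` is an embedding. -/
def squeezeDomain (ε : ℝ) : Set (PhaseSpace 3) :=
  {p | |(p 0).1| < 1 / 2 ∧ |(p 0).2| < ε ∧ |2 * (p 1).1 - 1| < 1 / 8 ∧ |(p 2).1| < 1 / 2}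

theorem isOpen_squeezeDomain (ε : ℝ) : IsOpen (squeezeDomain ε) := by
  refine IsOpen.and (isOpen_lt ?_ continuous_const) (.and (isOpen_lt ?_ continuous_const)
    (.and (isOpen_lt ?_ continuous_const) (isOpen_lt ?_ continuous_const))) <;> fun_prop

theorem twist_eq_shift {k : ℝ} {p : PhaseSpace 3} (h : (p 1).1 ^ 2 + (p 1).2 ^ 2 ≤ 3 / 2) :
    twist k p = shift k p := by
  simp [twist, shift, radialStep_of_le h]

theorem twist_eq_shift_add_one {k : ℝ} {p : PhaseSpace 3}
    (h : 5 / 2 ≤ (p 1).1 ^ 2 + (p 1).2 ^ 2) : twist k p = shift (k + 1) p := by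
  simp [twist, shift, radialStep_of_ge h, add_assoc]

theorem sq_add_sq_twist (k : ℝ) (p : PhaseSpace 3) :
    (twist k p 1).1 ^ 2 + (twist k p 1).2 ^ 2 = (p 1).1 ^ 2 + (p 1).2 ^ 2 := by
  simp only [twist, Matrix.cons_val]
  linear_combination ((p 1).1 ^ 2 + (p 1).2 ^ 2) * Real.sin_sq_add_cos_sq
    (2 * (p 2).2 * deriv radialStep ((p 1).1 ^ 2 + (p 1).2 ^ 2))

/-- The rotation angle depends only on the squared radius and on v, both preserved, so the two
rotations agree and can be undone. -/
theorem twist_eq_twist {k l : ℝ} {p q : PhaseSpace 3} (h : twist k p = twist l q) :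
    p 0 = q 0 ∧ p 1 = q 1 ∧ (p 2).1 + k = (q 2).1 + l ∧ (p 2).2 = (q 2).2 := by
  have hs := sq_add_sq_twist k p
  rw [h, sq_add_sq_twist] at hs
  have h0 := congrFun h 0
  have h1 := congrFun h 1
  have h2 := congrFun h 2
  simp only [twist, Matrix.cons_val, Prod.mk.injEq, hs] at h0 h1 h2
  rw [h2.2] at h1
  refine ⟨h0, ?_, by linarith [h2.1], h2.2⟩
  set φ := 2 * (q 2).2 * deriv radialStep ((p 1).1 ^ 2 + (p 1).2 ^ 2)
  have hcs := Real.sin_sq_add_cos_sq φ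
  obtain ⟨a, b⟩ := h1
  ext
  · linear_combination Real.cos φ * a - Real.sin φ * b - ((p 1).1 - (q 1).1) * hcs
  · linear_combination Real.sin φ * a + Real.cos φ * b - ((p 1).2 - (q 1).2) * hcs

theorem shift_eq_shift {k l : ℝ} {p q : PhaseSpace 3} (h : shift k p = shift l q) :
    p 0 = q 0 ∧ p 1 = q 1 ∧ (p 2).1 + k = (q 2).1 + l ∧ (p 2).2 = (q 2).2 := by
  have h0 := congrFun h 0
  have h1 := congrFun h 1
  have h2 := congrFun h 2
  simp only [shift, Matrix.cons_val, Prod.mk.injEq] at h0 h1 h2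
  exact ⟨h0, h1, h2.1, h2.2⟩

section Squeeze

variable {ε : ℝ} (hε : ∀ y, ε * |deriv lowerBump y| ≤ 1 / 16)

include hε

theorem abs_lift_lt {p : PhaseSpace 3} (hp : p ∈ squeezeDomain ε) :
    |2 * (lift p 1).1 - 1| < 1 / 4 := by
  obtain ⟨-, h2, h3, -⟩ := hp
  have h : |(p 0).2 * deriv lowerBump (p 1).2| ≤ 1 / 16 := by
    rw [abs_mul]
    exact (mul_le_mul_of_nonneg_right h2.le (abs_nonneg _)).trans (hε _)
  simp only [lift, Matrix.cons_val]
  rw [abs_lt] at h3 ⊢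
  rw [abs_le] at h
  constructor <;> linarith

theorem lift_fst_pos {p : PhaseSpace 3} (hp : p ∈ squeezeDomain ε) : 0 < (lift p 1).1 := by
  have := abs_lt.1 (abs_lift_lt hε hp)
  linarith

theorem isSymplecticAt_liftPolar {p : PhaseSpace 3} (hp : p ∈ squeezeDomain ε) :
    IsSymplecticAt liftPolar p := by
  have h : IsSymplecticAt (fun (q : PhaseSpace 3) i =>
      (![id, polar 1, id] : Fin 3 → ℝ × ℝ → ℝ × ℝ) i (q i)) (lift p) := by
    refine .pi (forall_fin_three.2 ⟨isAreaPreservingAt_id _,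
      isAreaPreservingAt_polar _ (lift_fst_pos hε hp), isAreaPreservingAt_id _⟩)
  have e : liftPolar = (fun (q : PhaseSpace 3) i =>
      (![id, polar 1, id] : Fin 3 → ℝ × ℝ → ℝ × ℝ) i (q i)) ∘ lift := by
    funext p i
    fin_cases i <;> rfl
  rw [e]
  exact h.comp (isSymplecticAt_lift p)

/-- The window exceeds the upper half turn by π/3 at each end. On these margins `radialStep` is
constant, so `twist` is a translation and matches the neighbouring `shift`; the jumps in the
definition of `squeeze` are only apparent. -/
theorem squeeze_eq_twist {p : PhaseSpace 3} (hp : p ∈ squeezeDomain ε) {k : ℤ}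
    (h1 : k * (2 * Real.pi) - Real.pi / 3 < (p 1).2)
    (h2 : (p 1).2 < k * (2 * Real.pi) + 4 * Real.pi / 3) :
    squeeze p = twist k (liftPolar p) := by
  have hpi := Real.pi_pos
  have hA := abs_lift_lt hε hp
  obtain ⟨θ, hθ⟩ : ∃ θ, (p 1).2 = θ + k * (2 * Real.pi) := ⟨_, (sub_add_cancel _ _).symm⟩
  have hsin : Real.sin (p 1).2 = Real.sin θ := by rw [hθ, Real.sin_add_int_mul_two_pi]
  have hcos : Real.cos (lift p 1).2 = Real.cos θ := by
    simp only [lift, Matrix.cons_val]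
    rw [hθ, Real.cos_add_int_mul_two_pi]
  have hfl : (p 1).2 / (2 * Real.pi) = θ / (2 * Real.pi) + k := by
    rw [hθ]; field_simp
  unfold squeeze
  rw [hsin, hfl, Int.floor_add_intCast]
  rcases lt_or_ge θ 0 with h | h
  · have hs : Real.sin θ < 0 := Real.sin_neg_of_neg_of_neg_pi_lt h (by linarith)
    -- Just before angle 2πk the floor is k - 1, and the `+ 1` in the lower branch restores k.
    have hf : ⌊θ / (2 * Real.pi)⌋ = -1 := by
      rw [Int.floor_eq_iff, le_div_iff₀ (by positivity), div_lt_iff₀ (by positivity)]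
      push_cast
      constructor <;> linarith
    have hc := half_le_cos_of_abs_le (x := θ) (by rw [abs_le]; constructor <;> linarith)
    rw [if_neg (not_le.2 hs), hf, twist_eq_shift (p := liftPolar p) (polarNormSq_le hA (hcos ▸ hc))]
    push_cast
    congr 1
    ring
  have hf : ⌊θ / (2 * Real.pi)⌋ = 0 := by
    rw [Int.floor_eq_iff, le_div_iff₀ (by positivity), div_lt_iff₀ (by positivity)]
    push_cast
    constructor <;> linarith
  rw [hf, zero_add]
  rcases le_or_gt θ Real.pi with h' | h'
  · rw [if_pos (Real.sin_nonneg_of_nonneg_of_le_pi h h')]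
  · have hs : Real.sin θ < 0 := by
      rw [← neg_pos, ← Real.sin_sub_pi]
      exact Real.sin_pos_of_pos_of_lt_pi (by linarith) (by linarith)
    have hc := cos_le_neg_half_of_abs_sub_pi_le (x := θ) (by rw [abs_le]; constructor <;> linarith)
    rw [if_neg (not_le.2 hs),
      twist_eq_shift_add_one (p := liftPolar p) (le_polarNormSq hA (hcos ▸ hc))]

theorem squeeze_eq_shift {p : PhaseSpace 3} (hp : p ∈ squeezeDomain ε) {k : ℤ}
    (h1 : k * (2 * Real.pi) + 2 * Real.pi / 3 < (p 1).2)
    (h2 : (p 1).2 < k * (2 * Real.pi) + 7 * Real.pi / 3) :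
    squeeze p = shift (k + 1) (liftPolar p) := by
  have hpi := Real.pi_pos
  have hA := abs_lift_lt hε hp
  obtain ⟨θ, hθ⟩ : ∃ θ, (p 1).2 = θ + k * (2 * Real.pi) := ⟨_, (sub_add_cancel _ _).symm⟩
  have hsin : Real.sin (p 1).2 = Real.sin θ := by rw [hθ, Real.sin_add_int_mul_two_pi]
  have hcos : Real.cos (lift p 1).2 = Real.cos θ := by
    simp only [lift, Matrix.cons_val]
    rw [hθ, Real.cos_add_int_mul_two_pi]
  rcases lt_or_ge (p 1).2 (k * (2 * Real.pi) + 4 * Real.pi / 3) with h | h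
  · rw [squeeze_eq_twist hε hp (by linarith) h]
    have hc := cos_le_neg_half_of_abs_sub_pi_le (x := θ) (by rw [abs_le]; constructor <;> linarith)
    rw [twist_eq_shift_add_one (p := liftPolar p) (le_polarNormSq hA (hcos ▸ hc))]
  rcases lt_or_ge θ (2 * Real.pi) with h' | h'
  · have hfl : (p 1).2 / (2 * Real.pi) = θ / (2 * Real.pi) + k := by
      rw [hθ]; field_simp
    have hs : Real.sin θ < 0 := by
      rw [← neg_pos, ← Real.sin_sub_pi]
      exact Real.sin_pos_of_pos_of_lt_pi (by linarith) (by linarith)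
    have hf : ⌊θ / (2 * Real.pi)⌋ = 0 := by
      rw [Int.floor_eq_iff, le_div_iff₀ (by positivity), div_lt_iff₀ (by positivity)]
      push_cast
      constructor <;> linarith
    unfold squeeze
    rw [hsin, hfl, Int.floor_add_intCast, if_neg (not_le.2 hs), hf, zero_add]
  · rw [squeeze_eq_twist hε hp (k := k + 1) (by push_cast; linarith) (by push_cast; linarith)]
    have hc := half_le_cos_of_abs_le (x := θ - 2 * Real.pi)
      (by rw [abs_le]; constructor <;> linarith)
    rw [Real.cos_sub_two_pi, ← hcos] at hc
    rw [twist_eq_shift (p := liftPolar p) (polarNormSq_le hA hc)]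
    push_cast
    rfl

/-- The open windows of `squeeze_eq_twist` and `squeeze_eq_shift` together cover every angle. -/
theorem isSymplecticAt_squeeze {p : PhaseSpace 3} (hp : p ∈ squeezeDomain ε) :
    IsSymplecticAt squeeze p := by
  have hpi := Real.pi_pos
  have hL := isSymplecticAt_liftPolar hε hp
  have hfl := Int.floor_le ((p 1).2 / (2 * Real.pi))
  have hfl' := Int.lt_floor_add_one ((p 1).2 / (2 * Real.pi))
  set k := ⌊(p 1).2 / (2 * Real.pi)⌋
  rw [le_div_iff₀ (by positivity)] at hfl
  rw [div_lt_iff₀ (by positivity)] at hfl'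
  have hD := (isOpen_squeezeDomain ε).mem_nhds hp
  have hopen : ∀ a b : ℝ, a < (p 1).2 → (p 1).2 < b →
      ∀ᶠ q : PhaseSpace 3 in nhds p, a < (q 1).2 ∧ (q 1).2 < b := fun a b ha hb =>
    (hasFDerivAt_coord_snd (1 : Fin 3) p).continuousAt.eventually
      (Ioo_mem_nhds ha hb)
  rcases le_or_gt (p 1).2 (k * (2 * Real.pi) + Real.pi) with h | h
  · refine ((isSymplecticAt_twist k _).comp hL).congr ?_
    filter_upwards [hD, hopen (k * (2 * Real.pi) - Real.pi / 3)
      (k * (2 * Real.pi) + 4 * Real.pi / 3) (by linarith) (by linarith)] with q hq hq'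
    exact squeeze_eq_twist hε hq hq'.1 hq'.2
  · refine ((isSymplecticAt_shift (k + 1) _).comp hL).congr ?_
    filter_upwards [hD, hopen (k * (2 * Real.pi) + 2 * Real.pi / 3)
      (k * (2 * Real.pi) + 7 * Real.pi / 3) (by linarith) (by linarith)] with q hq hq'
    exact squeeze_eq_shift hε hq hq'.1 hq'.2

/-- The angles differ by j full turns, which displaces the third factor by j; its width is less than
1, so j = 0. -/
theorem eq_of_liftPolar_eq {p q : PhaseSpace 3} (hp : p ∈ squeezeDomain ε)
    (hq : q ∈ squeezeDomain ε) (h0 : liftPolar p 0 = liftPolar q 0)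
    (h1 : liftPolar p 1 = liftPolar q 1)
    (h2 : (p 2).1 + ⌊(p 1).2 / (2 * Real.pi)⌋ = (q 2).1 + ⌊(q 1).2 / (2 * Real.pi)⌋)
    (h3 : (p 2).2 = (q 2).2) : p = q := by
  have hpi := Real.pi_pos
  obtain ⟨e1, j, hj⟩ := polar_eq_polar (lift_fst_pos hε hp) (lift_fst_pos hε hq) h1
  simp only [lift, Matrix.cons_val] at hj e1
  have hfl : (p 1).2 / (2 * Real.pi) = (q 1).2 / (2 * Real.pi) + j := by
    rw [hj]; field_simp
  rw [hfl, Int.floor_add_intCast, Int.cast_add] at h2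
  have hj0 : j = 0 := by
    have a := abs_lt.1 hp.2.2.2
    have b := abs_lt.1 hq.2.2.2
    have c : |(j : ℝ)| < 1 := by rw [abs_lt]; constructor <;> linarith
    exact Int.abs_lt_one_iff.1 (by exact_mod_cast c)
  subst hj0
  have hY : (p 1).2 = (q 1).2 := by simpa using hj
  have h0' : lift p 0 = lift q 0 := h0
  simp only [lift, Matrix.cons_val, Prod.mk.injEq, hY, add_left_inj] at h0'
  rw [hY, h0'.2, add_left_inj] at e1
  funext i
  fin_cases i
  · exact Prod.ext h0'.1 h0'.2
  · exact Prod.ext e1 hY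
  · exact Prod.ext (by simpa using h2) h3

theorem twist_ne_shift {p q : PhaseSpace 3} (hp : p ∈ squeezeDomain ε)
    (hq : q ∈ squeezeDomain ε) (hps : 0 ≤ Real.sin (p 1).2) (hqs : Real.sin (q 1).2 < 0)
    (k l : ℝ) : twist k (liftPolar p) ≠ shift l (liftPolar q) := by
  intro h
  have hpolar : liftPolar p 1 ≠ liftPolar q 1 := by
    intro h1
    obtain ⟨-, j, hj⟩ := polar_eq_polar (lift_fst_pos hε hp) (lift_fst_pos hε hq) h1
    simp only [lift, Matrix.cons_val] at hj
    rw [hj, Real.sin_add_int_mul_two_pi] at hps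
    exact absurd hqs (not_lt.2 hps)
  have hs := sq_add_sq_twist k (liftPolar p)
  have hA := abs_lift_lt hε hq
  rcases le_or_gt ((liftPolar p 1).1 ^ 2 + (liftPolar p 1).2 ^ 2) (3 / 2) with h1 | h1
  · rw [twist_eq_shift h1] at h
    exact hpolar (shift_eq_shift h).2.1
  rcases le_or_gt (5 / 2) ((liftPolar p 1).1 ^ 2 + (liftPolar p 1).2 ^ 2) with h2 | h2
  · rw [twist_eq_shift_add_one h2] at h
    exact hpolar (shift_eq_shift h).2.1
  -- In the transition zone the lower point has sine below -1/2, so it is lifted by exactly 1 while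
  -- the upper point is not lifted; first coordinates in (-1/2, 1/2) cannot then agree.
  · rw [h] at hs
    have hs' : polarNormSq (lift q 1) = (liftPolar p 1).1 ^ 2 + (liftPolar p 1).2 ^ 2 := hs
    rw [← hs'] at h1 h2
    have hsin : 1 / 4 < Real.sin (q 1).2 ^ 2 := sin_sq_gt_of_polarNormSq (z := lift q 1) hA h1 h2
    have hb := lowerBump_of_sin_le (y := (q 1).2) (by nlinarith)
    have ha := lowerBump_of_sin_nonneg hps
    have h0 : lift p 0 = lift q 0 := congrFun h 0
    simp only [lift, Matrix.cons_val, Prod.mk.injEq, ha, hb] at h0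
    have := abs_lt.1 hp.1
    have := abs_lt.1 hq.1
    linarith [h0.1]

theorem injOn_squeeze : (squeezeDomain ε).InjOn squeeze := by
  intro p hp q hq h
  unfold squeeze at h
  split_ifs at h with h1 h2 h2
  · obtain ⟨a, b, c, d⟩ := twist_eq_twist h
    exact eq_of_liftPolar_eq hε hp hq a b c d
  · exact absurd h (twist_ne_shift hε hp hq h1 (not_le.1 h2) _ _)
  · exact absurd h.symm (twist_ne_shift hε hq hp h2 (not_le.1 h1) _ _)
  · obtain ⟨a, b, c, d⟩ := shift_eq_shift h
    rw [← add_assoc, ← add_assoc] at c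
    exact eq_of_liftPolar_eq hε hp hq a b (add_right_cancel c) d

theorem squeeze_bounds {p : PhaseSpace 3} (hp : p ∈ squeezeDomain ε) :
    |(squeeze p 0).1| < 3 / 2 ∧ |(squeeze p 0).2| < ε ∧
      (squeeze p 1).1 ^ 2 + (squeeze p 1).2 ^ 2 < 9 ∧
      |(squeeze p 2).1| < 3 + |(p 1).2| ∧ (squeeze p 2).2 = (p 2).2 := by
  have hpi := Real.pi_gt_three
  have hb0 : 0 ≤ lowerBump (p 1).2 := Real.smoothTransition.nonneg _
  have hb1 : lowerBump (p 1).2 ≤ 1 := Real.smoothTransition.le_one _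
  have hx := abs_lt.1 hp.1
  have hu := abs_lt.1 hp.2.2.2
  have e0 : squeeze p 0 = lift p 0 := by unfold squeeze; split_ifs <;> rfl
  have e2 : (squeeze p 2).2 = (p 2).2 := by unfold squeeze; split_ifs <;> rfl
  have e1 : (squeeze p 1).1 ^ 2 + (squeeze p 1).2 ^ 2 = polarNormSq (lift p 1) := by
    unfold squeeze
    split_ifs
    · exact sq_add_sq_twist _ _
    · rfl
  obtain ⟨t, ht0, ht1, ht⟩ : ∃ t : ℝ, 0 ≤ t ∧ t ≤ 1 ∧
      (squeeze p 2).1 = (p 2).1 + ⌊(p 1).2 / (2 * Real.pi)⌋ + t := by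
    unfold squeeze
    split_ifs
    · exact ⟨_, Real.smoothTransition.nonneg _, Real.smoothTransition.le_one _, rfl⟩
    · exact ⟨1, zero_le_one, le_rfl, (add_assoc _ _ _).symm⟩
  refine ⟨?_, ?_, ?_, ?_, e2⟩
  · rw [e0]
    simp only [lift, Matrix.cons_val]
    rw [abs_lt]
    constructor <;> linarith
  · rw [e0]
    exact hp.2.1
  · rw [e1]
    exact polarNormSq_lt (abs_lift_lt hε hp)
  · have f1 := Int.floor_le ((p 1).2 / (2 * Real.pi))
    have f2 := Int.lt_floor_add_one ((p 1).2 / (2 * Real.pi))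
    have f3 : |(p 1).2 / (2 * Real.pi)| ≤ |(p 1).2| := by
      rw [abs_div, abs_of_pos (show 0 < 2 * Real.pi by positivity)]
      exact div_le_self (abs_nonneg _) (by linarith)
    rw [abs_le] at f3
    rw [ht, abs_lt]
    constructor <;> linarith

theorem exists_embeds_squeeze_of_fixed (hε0 : 0 < ε) (hε1 : ε ≤ 1 / 2) {b c : ℝ} (hb : ε ≤ b)
    (hc : 0 < c) : SymplecticallyEmbeds (polydisk ![ε, b, c])
      (polydisk ![3, 3, (3 / ε ^ 2 + 18) * (b * c)]) := by
  have hb0 : 0 < b := hε0.trans_le hb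
  -- The factor 1/(16b) makes the strip thin enough for |2X - 1| < 1/8; its length is of order b².
  set S : PhaseSpace 3 → PhaseSpace 3 := fun p i =>
    (![id, stretch (1 / (16 * b)) (1 / 2) 0, stretch (1 / (2 * c)) 0 0] :
      Fin 3 → ℝ × ℝ → ℝ × ℝ) i (p i) with hS
  -- After `squeeze`, u has range of order b² and v of order c²; the ratio c/b balances both to
  -- order bc.
  set T : PhaseSpace 3 → PhaseSpace 3 := fun p i =>
    (![id, id, stretch (c / b) 0 0] : Fin 3 → ℝ × ℝ → ℝ × ℝ) i (p i) with hT
  have hSinj : Function.Injective S := by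
    intro p q h
    refine funext (forall_fin_three.2 ⟨congrFun h 0, ?_, ?_⟩)
    · exact stretch_injective (by positivity) _ _ (congrFun h 1)
    · exact stretch_injective (by positivity) _ _ (congrFun h 2)
  have hTinj : Function.Injective T := by
    intro p q h
    refine funext (forall_fin_three.2 ⟨congrFun h 0, congrFun h 1, ?_⟩)
    exact stretch_injective (by positivity) _ _ (congrFun h 2)
  have hmem : ∀ p ∈ polydisk ![ε, b, c],
      S p ∈ squeezeDomain ε ∧ |(S p 1).2| < 16 * b ^ 2 ∧ |(S p 2).2| < 2 * c ^ 2 := by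
    intro p hp
    have h0 : (p 0).1 ^ 2 + (p 0).2 ^ 2 < ε ^ 2 := hp 0
    have hx : |(p 0).1| < ε := abs_lt_of_sq_lt_sq (by nlinarith [sq_nonneg (p 0).2]) hε0.le
    have hy : |(p 0).2| < ε := abs_lt_of_sq_lt_sq (by nlinarith [sq_nonneg (p 0).1]) hε0.le
    obtain ⟨h1, h1'⟩ := abs_stretch_sub_lt (r := b) (a := 1 / (16 * b)) (b := 1 / 2) (c := 0)
      (by positivity) (hp 1) hb0
    obtain ⟨h2, h2'⟩ := abs_stretch_sub_lt (r := c) (a := 1 / (2 * c)) (b := 0) (c := 0)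
      (by positivity) (hp 2) hc
    have w1 : 1 / (16 * b) * b = 1 / 16 := by field_simp
    have w1' : (1 / (16 * b))⁻¹ * b = 16 * b ^ 2 := by field_simp
    have w2 : 1 / (2 * c) * c = 1 / 2 := by field_simp
    have w2' : (1 / (2 * c))⁻¹ * c = 2 * c ^ 2 := by field_simp
    rw [w1] at h1
    rw [w1', sub_zero] at h1'
    rw [w2, sub_zero] at h2
    rw [w2', sub_zero] at h2'
    refine ⟨⟨hx.trans_le hε1, hy, ?_, h2⟩, h1', h2'⟩
    change |2 * (stretch (1 / (16 * b)) (1 / 2) 0 (p 1)).1 - 1| < 1 / 8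
    rw [abs_lt] at h1 ⊢
    constructor <;> linarith
  refine ⟨T ∘ squeeze ∘ S, isSymplecticEmbedding_of_injOn (isOpen_polydisk _) (fun p hp => ?_)
    (fun p hp q hq h => hSinj (injOn_squeeze hε (hmem p hp).1 (hmem q hq).1 (hTinj h)))
    (fun p hp => forall_fin_three.2 ?_)⟩
  · refine IsSymplecticAt.comp (.pi (forall_fin_three.2 ⟨isAreaPreservingAt_id _,
      isAreaPreservingAt_id _, isAreaPreservingAt_stretch (by positivity) _ _ _⟩))
      ((isSymplecticAt_squeeze hε (hmem p hp).1).comp (.pi (forall_fin_three.2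
        ⟨isAreaPreservingAt_id _, isAreaPreservingAt_stretch (by positivity) _ _ _,
          isAreaPreservingAt_stretch (by positivity) _ _ _⟩)))
  · obtain ⟨hD, hY, hv⟩ := hmem p hp
    obtain ⟨h1, h2, h3, h4, h5⟩ := squeeze_bounds hε hD
    rw [← h5] at hv
    set w := squeeze (S p)
    refine ⟨?_, ?_, ?_⟩
    · change (w 0).1 ^ 2 + (w 0).2 ^ 2 < 3 ^ 2
      have h2' : |(w 0).2| < 1 / 2 := h2.trans_le hε1
      rw [abs_lt] at h1 h2'
      nlinarith
    · change (w 1).1 ^ 2 + (w 1).2 ^ 2 < 3 ^ 2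
      linarith
    · change (c / b * (w 2).1 + 0) ^ 2 + ((c / b)⁻¹ * (w 2).2 + 0) ^ 2
        < ((3 / ε ^ 2 + 18) * (b * c)) ^ 2
      have hu : |c / b * (w 2).1 + 0| < (3 / ε ^ 2 + 16) * (b * c) := by
        rw [add_zero, abs_mul, abs_of_pos (by positivity)]
        -- The assumption ε ≤ b absorbs the additive 3 into a multiple of b².
        have hb2 : 3 ≤ 3 / ε ^ 2 * b ^ 2 := by
          rw [div_mul_eq_mul_div, le_div_iff₀ (by positivity)]
          have : ε ^ 2 ≤ b ^ 2 := by gcongr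
          linarith
        calc c / b * |(w 2).1| < c / b * ((3 / ε ^ 2 + 16) * b ^ 2) :=
              mul_lt_mul_of_pos_left (by linarith) (by positivity)
          _ = _ := by field_simp
      have hv' : |(c / b)⁻¹ * (w 2).2 + 0| < 2 * (b * c) := by
        rw [add_zero, abs_mul, abs_of_pos (by positivity)]
        calc (c / b)⁻¹ * |(w 2).2| < (c / b)⁻¹ * (2 * c ^ 2) :=
              mul_lt_mul_of_pos_left hv (by positivity)
          _ = _ := by field_simp
      rw [← sq_abs (c / b * (w 2).1 + 0), ← sq_abs ((c / b)⁻¹ * (w 2).2 + 0)]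
      have hs : |c / b * (w 2).1 + 0| + |(c / b)⁻¹ * (w 2).2 + 0|
          < (3 / ε ^ 2 + 18) * (b * c) := by linarith
      have n1 := abs_nonneg (c / b * (w 2).1 + 0)
      have n2 := abs_nonneg ((c / b)⁻¹ * (w 2).2 + 0)
      calc _ ≤ (|c / b * (w 2).1 + 0| + |(c / b)⁻¹ * (w 2).2 + 0|) ^ 2 := by
            linarith [mul_nonneg n1 n2, add_sq (|c / b * (w 2).1 + 0|) (|(c / b)⁻¹ * (w 2).2 + 0|)]
        _ < _ := by gcongr

end Squeeze

theorem exists_embeds_squeeze : ∃ C : ℝ, 1 ≤ C ∧ ∀ a b c : ℝ, 0 < a → a ≤ b → 0 < c →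
    SymplecticallyEmbeds (polydisk ![a, b, c])
      (polydisk ![C * a, C * a, C * (b * c / a)]) := by
  obtain ⟨M, hM, hMle⟩ := exists_abs_deriv_lowerBump_le
  obtain ⟨ε, hε0, hε1, hε⟩ : ∃ ε : ℝ, 0 < ε ∧ ε ≤ 1 / 2 ∧
      ∀ y, ε * |deriv lowerBump y| ≤ 1 / 16 := by
    refine ⟨min (1 / 2) (1 / (16 * M)), by positivity, min_le_left _ _, fun y => ?_⟩
    calc _ ≤ 1 / (16 * M) * M :=
          mul_le_mul (min_le_right _ _) (hMle y) (abs_nonneg _) (by positivity)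
      _ = 1 / 16 := by field_simp
  set K := 3 / ε ^ 2 + 18 with hK
  have hK0 : 0 < K := by positivity
  refine ⟨1 + 3 / ε + K * ε, by linarith [show 0 < 3 / ε + K * ε by positivity],
    fun a b c ha hab hc => ?_⟩
  have hb : 0 < b := ha.trans_le hab
  -- Rescaling by a/ε reduces to a first radius equal to ε, fixed once and for all.
  have h := (exists_embeds_squeeze_of_fixed hε hε0 hε1 (b := b * ε / a) (c := c * ε / a)
    (by rw [le_div_iff₀ ha, mul_comm]; gcongr) (by positivity)).smul (c := a / ε) (by positivity)
  have e1 : (fun i => a / ε * (![ε, b * ε / a, c * ε / a] : Fin 3 → ℝ) i) = ![a, b, c] := by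
    funext i
    fin_cases i
    all_goals
      simp only [Fin.zero_eta, Fin.mk_one, Fin.reduceFinMk, Matrix.cons_val]
      field_simp
  rw [e1] at h
  refine h.trans (isOpen_polydisk _) (isOpen_polydisk _) (SymplecticallyEmbeds.of_subset
    (isOpen_polydisk _) (polydisk_subset (forall_fin_three.2 ?_) (forall_fin_three.2 ?_)))
  · simp only [Matrix.cons_val]
    refine ⟨?_, ?_, ?_⟩ <;> positivity
  · simp only [Matrix.cons_val]
    have h3 : a / ε * 3 ≤ (1 + 3 / ε + K * ε) * a := by
      have : a / ε * 3 = 3 / ε * a := by ring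
      rw [this]
      exact mul_le_mul_of_nonneg_right (by linarith [mul_pos hK0 hε0]) ha.le
    refine ⟨h3, h3, ?_⟩
    have : a / ε * (K * (b * ε / a * (c * ε / a))) = K * ε * (b * c / a) := by field_simp
    rw [this]
    exact mul_le_mul_of_nonneg_right (by linarith [show 0 < 3 / ε by positivity]) (by positivity)

/-! ### Combining the elementary embeddings -/

section Combination

variable {n : ℕ}

theorem SymplecticallyEmbeds.polydisk_trans {C D : ℝ} (hC : 0 < C) {R S T : Fin n → ℝ}
    (h : SymplecticallyEmbeds (polydisk R) (polydisk fun i => C * S i))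
    (h' : SymplecticallyEmbeds (polydisk S) (polydisk fun i => D * T i)) :
    SymplecticallyEmbeds (polydisk R) (polydisk fun i => C * D * T i) := by
  have := h.trans (isOpen_polydisk _) (isOpen_polydisk _) (h'.smul hC)
  simpa only [mul_assoc] using this

/-- `polydisk R` embeds in `polydisk (C • R')` whenever `R'` arises from `R` by one of the two
elementary moves, with positions of the radii arbitrary. -/
theorem exists_embeds_moves : ∃ C : ℝ, 1 ≤ C ∧ ∀ (n : ℕ) (R : Fin n → ℝ), (∀ i, 0 < R i) →
    (∀ i j, i ≠ j → ∀ r, R i ≤ r → r ≤ R j →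
      SymplecticallyEmbeds (polydisk R) (polydisk fun l => C *
        Function.update (Function.update R i r) j (R j * R i / r) l)) ∧
    (∀ i j k, i ≠ j → i ≠ k → j ≠ k → R i ≤ R j →
      SymplecticallyEmbeds (polydisk R) (polydisk fun l => C *
        Function.update (Function.update R j (R i)) k (R j * R k / R i) l)) := by
  obtain ⟨C₁, hC₁, h₁⟩ := exists_embeds_fold
  obtain ⟨C₂, hC₂, h₂⟩ := exists_embeds_squeeze
  have h₀ : ∀ {C c : ℝ}, 1 ≤ C → 0 < c → c ≤ C * c := fun hC hc => le_mul_of_one_le_left hc.le hC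
  refine ⟨max C₁ C₂, le_max_of_le_left hC₁, fun n R hR => ⟨?_, ?_⟩⟩
  · intro i j hij r hir hrj
    have hri : 0 < r := (hR i).trans_le hir
    have hinj : Function.Injective ![i, j] := by
      intro x y; fin_cases x <;> fin_cases y <;> simp [hij, hij.symm]
    set S := Function.update (Function.update R i r) j (R j * R i / r) with hS
    have hSpos : ∀ l, 0 < S l := by
      intro l
      by_cases hl : l = j
      · subst hl; simp only [hS, Function.update_self]; have := hR l; have := hR i; positivity
      by_cases hl' : l = i
      · subst hl'; simpa [hS, Function.update_of_ne hl] using hri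
      · simpa [hS, Function.update_of_ne hl, Function.update_of_ne hl'] using hR l
    have key : SymplecticallyEmbeds (polydisk R)
        (polydisk fun l => if l = i ∨ l = j then C₁ * S l else R l) := by
      refine SymplecticallyEmbeds.extend hinj (fun l hl => ?_) ?_
      · have h1 := hl 0
        have h2 := hl 1
        simp only [Matrix.cons_val_zero, Matrix.cons_val_one] at h1 h2
        simp [Ne.symm h1, Ne.symm h2]
      · have := h₁ (R i) (R j) (r / R i) (hR i) ((one_le_div (hR i)).2 hir)
          (by rwa [mul_div_cancel₀ _ (hR i).ne'])
        convert this using 2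
        · funext x; fin_cases x <;> simp
        · funext x; fin_cases x
          · simp [hS, Function.update_of_ne hij, mul_div_cancel₀ _ (hR i).ne']
          · simp [hS]; left; field_simp
    refine key.trans (isOpen_polydisk _) (isOpen_polydisk _) (SymplecticallyEmbeds.of_subset
      (isOpen_polydisk _) (polydisk_subset (fun l => ?_) fun l => ?_))
    · split_ifs
      · exact mul_nonneg (by linarith) (hSpos l).le
      · exact (hR l).le
    · split_ifs with hl
      · exact mul_le_mul_of_nonneg_right (le_max_left _ _) (hSpos l).le
      · push Not at hl
        have : S l = R l := by simp [hS, Function.update_of_ne hl.1, Function.update_of_ne hl.2]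
        rw [this]
        exact h₀ (le_max_of_le_left hC₁) (hR l)
  · intro i j k hij hik hjk hle
    have hinj : Function.Injective ![i, j, k] := by
      intro x y; fin_cases x <;> fin_cases y <;> simp [hij, hij.symm, hik, hik.symm, hjk, hjk.symm]
    set S := Function.update (Function.update R j (R i)) k (R j * R k / R i) with hS
    have hSpos : ∀ l, 0 < S l := by
      intro l
      by_cases hl : l = k
      · subst hl; simp only [hS, Function.update_self]
        have := hR l; have := hR i; have := hR j; positivity
      by_cases hl' : l = j
      · subst hl'; simpa [hS, Function.update_of_ne hl] using hR i
      · simpa [hS, Function.update_of_ne hl, Function.update_of_ne hl'] using hR l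
    have key : SymplecticallyEmbeds (polydisk R)
        (polydisk fun l => if l = i ∨ l = j ∨ l = k then C₂ * S l else R l) := by
      refine SymplecticallyEmbeds.extend hinj (fun l hl => ?_) ?_
      · have h1 : i ≠ l := hl 0
        have h2 : j ≠ l := hl 1
        have h3 : k ≠ l := hl 2
        simp [Ne.symm h1, Ne.symm h2, Ne.symm h3]
      · have := h₂ (R i) (R j) (R k) (hR i) hle (hR k)
        convert this using 2
        · funext x; fin_cases x <;> simp
        · funext x; fin_cases x <;> simp [hS, hij, hik, hjk]
    refine key.trans (isOpen_polydisk _) (isOpen_polydisk _) (SymplecticallyEmbeds.of_subset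
      (isOpen_polydisk _) (polydisk_subset (fun l => ?_) fun l => ?_))
    · split_ifs
      · exact mul_nonneg (by linarith) (hSpos l).le
      · exact (hR l).le
    · split_ifs with hl
      · exact mul_le_mul_of_nonneg_right (le_max_right _ _) (hSpos l).le
      · push Not at hl
        have : S l = R l := by
          simp [hS, Function.update_of_ne hl.2.1, Function.update_of_ne hl.2.2]
        rw [this]
        exact h₀ (le_max_of_le_left hC₁) (hR l)

/-- The radii in `s` are lowered to `R o`, and the radius at `t` absorbs the product. -/
noncomputable def squeezed (R : Fin n → ℝ) (o t : Fin n) (s : Finset (Fin n)) (l : Fin n) : ℝ :=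
  if l = t then R t * ∏ j ∈ s, (R j / R o) else if l ∈ s then R o else R l

/-- The radii in `s` are those of `R`, those outside are `r`, except that the radius at `t` is
such that the product is that of `R`. -/
noncomputable def spread (R : Fin n → ℝ) (r : ℝ) (t : Fin n) (s : Finset (Fin n)) (l : Fin n) : ℝ :=
  if l = t then R t * ∏ j ∈ (Finset.univ.erase t) \ s, (R j / r) else if l ∈ s then R l else r

/-- Each new index is squeezed against the smallest radius `R o`, with `t` absorbing the lost
factor. -/
theorem embeds_squeezed {C : ℝ} (hC : 1 ≤ C) {R : Fin n → ℝ} {o t : Fin n} (hot : o ≠ t)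
    (hR : ∀ i, 0 < R i) (hle : ∀ i, R o ≤ R i)
    (hmove : ∀ (R : Fin n → ℝ), (∀ i, 0 < R i) → ∀ i j k, i ≠ j → i ≠ k → j ≠ k → R i ≤ R j →
      SymplecticallyEmbeds (polydisk R) (polydisk fun l => C *
        Function.update (Function.update R j (R i)) k (R j * R k / R i) l))
    (s : Finset (Fin n)) (hs : o ∉ s ∧ t ∉ s) :
    SymplecticallyEmbeds (polydisk R) (polydisk fun l => C ^ s.card * squeezed R o t s l) := by
  classical
  induction s using Finset.induction_on with
  | empty =>
    refine SymplecticallyEmbeds.of_subset (isOpen_polydisk _) (le_of_eq ?_)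
    congr 1; funext l
    by_cases h : l = t <;> simp [squeezed, h]
  | insert a s ha ih =>
    obtain ⟨ho, ht⟩ := hs
    simp only [Finset.mem_insert, not_or] at ho ht
    rw [Finset.card_insert_of_notMem ha, pow_succ]
    have hpos : ∀ i, 0 < squeezed R o t s i := by
      intro i
      unfold squeezed
      split_ifs
      · exact mul_pos (hR t) (Finset.prod_pos fun j _ => div_pos (hR j) (hR o))
      · exact hR o
      · exact hR i
    refine (ih ⟨ho.2, ht.2⟩).polydisk_trans (pow_pos (by linarith) _) ?_
    have hoo : squeezed R o t s o = R o := by simp [squeezed, hot]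
    have haa : squeezed R o t s a = R a := by simp [squeezed, Ne.symm ht.1, ha]
    have h := hmove (squeezed R o t s) hpos o a t ho.1 hot (Ne.symm ht.1)
      (by rw [hoo, haa]; exact hle a)
    convert h using 4 with l
    rw [hoo, haa]
    by_cases hlt : l = t
    · subst hlt
      simp only [squeezed, Function.update_self, if_true, Finset.prod_insert ha]
      ring
    · rw [Function.update_of_ne hlt]
      by_cases hla : l = a
      · subst hla; simp [squeezed, hlt]
      · simp [squeezed, hlt, hla]

/-- Each fold restores one radius from `r` to its target by giving back the factor stored at `t`. -/
theorem embeds_spread {C : ℝ} (hC : 1 ≤ C) {R : Fin n → ℝ} {r : ℝ} {t : Fin n}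
    (hr : 0 < r) (hle : ∀ i, r ≤ R i)
    (hmove : ∀ (R : Fin n → ℝ), (∀ i, 0 < R i) → ∀ i j, i ≠ j → ∀ r, R i ≤ r → r ≤ R j →
      SymplecticallyEmbeds (polydisk R) (polydisk fun l => C *
        Function.update (Function.update R i r) j (R j * R i / r) l))
    (s : Finset (Fin n)) (hs : t ∉ s) :
    SymplecticallyEmbeds (polydisk (spread R r t ∅))
      (polydisk fun l => C ^ s.card * spread R r t s l) := by
  classical
  have hR : ∀ i, 0 < R i := fun i => hr.trans_le (hle i)
  induction s using Finset.induction_on with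
  | empty =>
    refine SymplecticallyEmbeds.of_subset (isOpen_polydisk _) (le_of_eq ?_)
    simp
  | insert a s ha ih =>
    simp only [Finset.mem_insert, not_or] at hs
    rw [Finset.card_insert_of_notMem ha, pow_succ]
    have hpos : ∀ i, 0 < spread R r t s i := by
      intro i
      unfold spread
      split_ifs
      · exact mul_pos (hR t) (Finset.prod_pos fun j _ => div_pos (hR j) hr)
      · exact hR i
      · exact hr
    refine (ih hs.2).polydisk_trans (pow_pos (by linarith) _) ?_
    have haa : spread R r t s a = r := by simp [spread, Ne.symm hs.1, ha]
    have hprod : ∏ j ∈ (Finset.univ.erase t) \ s, (R j / r)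
        = R a / r * ∏ j ∈ (Finset.univ.erase t) \ insert a s, (R j / r) := by
      rw [Finset.sdiff_insert, Finset.mul_prod_erase (a := a) _ (fun j => R j / r)]
      simp [Ne.symm hs.1, ha]
    have htt : spread R r t s t
        = R t * (R a / r * ∏ j ∈ (Finset.univ.erase t) \ insert a s, (R j / r)) := by
      simp [spread, hprod]
    have hone : 1 ≤ ∏ j ∈ (Finset.univ.erase t) \ insert a s, (R j / r) :=
      Finset.prod_induction _ (fun x => 1 ≤ x) (fun _ _ => one_le_mul_of_one_le_of_one_le)
        le_rfl fun j _ => (one_le_div hr).2 (hle j)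
    -- Folding requires R a to be at most the current radius at t. The latter is R t · (R a / r)
    -- times factors at least 1, and r ≤ R t.
    have h := hmove (spread R r t s) hpos a t (Ne.symm hs.1) (R a)
      (by rw [haa]; exact hle a) (by
        rw [htt]
        calc R a = r * (R a / r * 1) := by field_simp
          _ ≤ _ := by
            have := hR a
            gcongr
            · exact (hR t).le
            · exact hle t)
    convert h using 4 with l
    rw [haa, htt]
    by_cases hlt : l = t
    · subst hlt
      simp only [spread, Function.update_self, if_true]
      have := (hR a).ne'
      field_simp
    · rw [Function.update_of_ne hlt]
      by_cases hla : l = a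
      · subst hla; simp [spread, hlt]
      · simp [spread, hlt, hla]

end Combination

theorem theorem1 (n : ℕ) (hn : 0 < n) :
    ∃ C : ℝ, 0 < C ∧
      ∀ R R' : Fin n → ℝ,
        (∀ i, 0 < R i) → (∀ i, 0 < R' i) → Monotone R → Monotone R' →
        R ⟨0, hn⟩ ≤ R' ⟨0, hn⟩ → ∏ i, R i ≤ ∏ i, R' i →
        SymplecticallyEmbeds (polydisk R) (polydisk (fun i => C * R' i)) := by
  classical
  obtain ⟨C, hC, hmoves⟩ := exists_embeds_moves
  set o : Fin n := ⟨0, hn⟩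
  set t : Fin n := ⟨n - 1, by omega⟩ with htdef
  have hCpos : 0 < C := by linarith
  -- For n = 1 neither move is available, and inclusion suffices.
  by_cases hot : o = t
  · refine ⟨1, one_pos, fun R R' hR _ _ _ h0 _ => SymplecticallyEmbeds.of_subset
      (isOpen_polydisk _) (polydisk_subset (fun i => (hR i).le) fun i => ?_)⟩
    have hn1 : n = 1 := by
      have := congrArg Fin.val hot
      simp [o, htdef] at this
      omega
    have : i = o := Fin.ext (by have := i.2; simp only [o]; omega)
    rw [this, one_mul]
    exact h0
  set s : Finset (Fin n) := (Finset.univ.erase t).erase o with hs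
  refine ⟨C ^ s.card * C ^ (Finset.univ.erase t).card, by positivity, ?_⟩
  intro R R' hR hR' hm hm' h0 hprod
  have hle : ∀ i, R o ≤ R i := fun i => hm (Fin.mk_le_of_le_val (Nat.zero_le _))
  have hle' : ∀ i, R o ≤ R' i := fun i =>
    h0.trans (hm' (Fin.mk_le_of_le_val (Nat.zero_le _)))
  have e1 := embeds_squeezed hC hot hR hle (fun R hR => (hmoves n R hR).2) s (by simp [hs])
  have e2 := embeds_spread (t := t) hC (hR o) hle' (fun R hR => (hmoves n R hR).1)
    (Finset.univ.erase t) (by simp)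
  refine e1.polydisk_trans (by positivity) (SymplecticallyEmbeds.trans
    (V := polydisk (spread R' (R o) t ∅)) (isOpen_polydisk _) (isOpen_polydisk _)
    (SymplecticallyEmbeds.of_subset (isOpen_polydisk _)
      (polydisk_subset (fun l => ?_) fun l => ?_)) ?_)
  · unfold squeezed
    split_ifs
    · exact (mul_pos (hR t) (Finset.prod_pos fun j _ => div_pos (hR j) (hR o))).le
    · exact (hR o).le
    · exact (hR l).le
  · by_cases hlt : l = t
    · rw [hlt]
      simp only [squeezed, spread, if_true, Finset.sdiff_empty]
      -- The factor at `o` is 1. With it included, both radii at `t` are full products divided by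
      -- the same power of `R o`, and the product hypothesis compares them.
      have hp1 : ∏ j ∈ s, (R j / R o) = ∏ j ∈ Finset.univ.erase t, (R j / R o) := by
        rw [hs]
        exact Finset.prod_erase _ (div_self (hR o).ne')
      rw [hp1, Finset.prod_div_distrib, Finset.prod_div_distrib, mul_div_assoc', mul_div_assoc',
        Finset.mul_prod_erase _ _ (Finset.mem_univ t), Finset.mul_prod_erase _ _ (Finset.mem_univ t)]
      exact div_le_div_of_nonneg_right hprod (Finset.prod_nonneg fun _ _ => (hR o).le)
    · by_cases hlo : l = o
      · subst hlo
        simp [squeezed, spread, hlt, hs]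
      · simp [squeezed, spread, hlt, hs, hlo]
  · convert e2 using 4 with l
    by_cases hlt : l = t <;> simp [spread, hlt]
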